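/- Let $n\in\mathbb N$, $3/2<s<2$, $\mathbb T=\mathbb R/\mathbb Z$ with Lebesgue measure and geodesic distance $d$, and let $d\mu(x,y)=\frac{dy\,dx}{d(y,x)}$ on $\mathbb T\times\mathbb T$. Let $H^s=H^s(\mathbb T;\mathbb R^n)$ be the space of all $u\in L^2(\mathbb T;\mathbb R^n)$ with weak derivative $u'\in L^2$ and $$\|u\|_{H^s}^2=\int_{\mathbb T}|u|^2\,dx+\int_{\mathbb T}|u'|^2\,dx+\int_{\mathbb T\times\mathbb T}\Big|\frac{u'(y)-u'(x)}{d(y,x)^{s-1}}\Big|^2d\mu(x,y)<\infty,$$ and let $\mathcal M\subset H^s$ be the set of all $\gamma\in H^s$ whose $C^1$ representative is an embedding (an injective immersion). For $\gamma\in\mathcal M$ and $u,v\in H^s$ put $$D_\gamma u=\frac{u'}{|\gamma'|},\qquad \mathcal D_\gamma u=\frac{u'}{|\gamma'|}\frac{\gamma'^{\top}}{|\gamma'|},\qquad d\mu_\gamma(x,y)=\frac{|\gamma'(y)|\,|\gamma'(x)|\,dy\,dx}{|\gamma(y)-\gamma(x)|},$$ $$R^s_\gamma u(x,y)=\frac{u(y)-u(x)-\mathcal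 D_\gamma u(x)(\gamma(y)-\gamma(x))}{|\gamma(y)-\gamma(x)|^s},\qquad \Lambda(\gamma)(x,y)=\frac{d(y,x)}{|\gamma(y)-\gamma(x)|},$$ $$B^1_\gamma(u,v)=\int\langle R^s_\gamma u,R^s_\gamma v\rangle\,d\mu_\gamma,\qquad B^2_\gamma(u,v)=\int|R^s_\gamma\gamma|^2\Big\langle\frac{u(y)-u(x)}{|\gamma(y)-\gamma(x)|},\frac{v(y)-v(x)}{|\gamma(y)-\gamma(x)|}\Big\rangle d\mu_\gamma,$$ $$B^3_\gamma(u,v)=\int|R^s_\gamma\gamma|^2\big(\langle D_\gamma u(x),D_\gamma v(x)\rangle+\langle D_\gamma u(y),D_\gamma v(y)\rangle\big)\,d\mu_\gamma,$$ $$G_\gamma(u,v)=2B^1_\gamma(u,v)+(2s+1)B^2_\gamma(u,v)+B^3_\gamma(u,v)+\int_{\mathbb T}\langle D_\gamma u,D_\gamma v\rangle|\gamma'|\,dx+\int_{\mathbb T}\langle u,v\rangle|\gamma'|\,dx,$$ and define the densities $$b^1_\gamma(u,v)=\langle R^s_\gamma u,R^s_\gamma v\rangle\,\Lambda(\gamma)\,|\gamma'(x)|\,|\gamma'(y)|,\qquad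 b^2_\gamma(u,v)=b^1_\gamma(\gamma,\gamma)\Big\langle\frac{u(y)-u(x)}{d(y,x)},\frac{v(y)-v(x)}{d(y,x)}\Big\rangle\Lambda(\gamma)^2,$$ $$b^3_\gamma(u,v)=b^1_\gamma(\gamma,\gamma)\big(\langle D_\gamma u(x),D_\gamma v(x)\rangle+\langle D_\gamma u(y),D_\gamma v(y)\rangle\big).$$ Then $\mathcal M$ is open in $H^s$. The metric $G$ is smooth: for every $\gamma\in\mathcal M$, $G_\gamma$ is a well-defined bounded bilinear form on $H^s$, and $\gamma\mapsto G_\gamma$ is a $C^\infty$ map from $\mathcal M$ into the Banach space $L(H^s;L(H^s;\mathbb R))$ of bounded bilinear forms. Moreover, for $i=1,2,3$, the map $(\gamma,u,v)\mapsto b^i_\gamma(u,v)$ is a $C^\infty$ map from $\mathcal M\times H^s\times H^s$ into $L^1(\mu)$, and $B^i_\gamma(u,v)=\int b^i_\gamma(u,v)\,d\mu$ for all $\gamma\in\mathcal M$ and $u,v\in H^s$; the integrands of the last two terms of $G_\gamma(u,v)$ are integrable. -/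

import Mathlib

open MeasureTheory Set
open scoped ContDiff ENNReal RealInnerProductSpace

namespace TangentPoint

/-- The circle `ℝ / ℤ` of length one, with its Lebesgue measure `volume` and its
geodesic distance `dist`. -/
abbrev Circ : Type := AddCircle (1 : ℝ)

/-- The ambient Euclidean space. -/
abbrev Amb (n : ℕ) : Type := EuclideanSpace ℝ (Fin n)

/-- The classical derivative of a map on the circle. -/
noncomputable def circDeriv {F : Type*} [NormedAddCommGroup F] [NormedSpace ℝ F]
    (f : Circ → F) (x : Circ) : F :=
  deriv (fun t : ℝ => f (x + (t : Circ))) 0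

/-- A map on the circle is of class `C^k` if its periodic lift to the line is. -/
def IsCk {F : Type*} [NormedAddCommGroup F] [NormedSpace ℝ F]
    (k : ℕ∞) (f : Circ → F) : Prop :=
  ContDiff ℝ k (fun t : ℝ => f (t : Circ))

/-- `w` is the weak derivative of `u`, tested against all smooth functions on the circle. -/
def IsWeakDeriv {n : ℕ} (u w : Circ → Amb n) : Prop :=
  ∀ φ : Circ → ℝ, IsCk ⊤ φ →
    ∫ x, circDeriv φ x • u x = - ∫ x, φ x • w x

/-- The measure `dμ(x,y) = dy dx / dist(y,x)` on the torus. -/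
noncomputable def mu : Measure (Circ × Circ) :=
  (volume.prod volume).withDensity (fun p => ENNReal.ofReal (dist p.2 p.1)⁻¹)

/-- The fractional difference operator `(u(y) - u(x)) / dist(y,x)^σ`. -/
noncomputable def fracDiff {n : ℕ} (σ : ℝ) (u : Circ → Amb n) (p : Circ × Circ) : Amb n :=
  (dist p.2 p.1 ^ σ)⁻¹ • (u p.2 - u p.1)

lemma ae_fst_mu {P : Circ → Prop} (h : ∀ᵐ x, P x) : ∀ᵐ p ∂mu, P p.1 :=
  (withDensity_absolutelyContinuous _ _).ae_le
    (Measure.quasiMeasurePreserving_fst.ae h)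

lemma ae_snd_mu {P : Circ → Prop} (h : ∀ᵐ x, P x) : ∀ᵐ p ∂mu, P p.2 :=
  (withDensity_absolutelyContinuous _ _).ae_le
    (Measure.quasiMeasurePreserving_snd.ae h)

lemma IsCk.continuous {φ : Circ → ℝ} {k : ℕ∞} (h : IsCk k φ) : Continuous φ := by
  have : Continuous (φ ∘ (QuotientAddGroup.mk : ℝ → Circ)) := ContDiff.continuous h
  exact (QuotientAddGroup.isQuotientMap_mk _).continuous_iff.2 this

lemma circDeriv_coe {φ : Circ → ℝ} (t : ℝ) :
    circDeriv φ (t : Circ) = deriv (fun r : ℝ => φ (r : Circ)) t := by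
  have := deriv_comp_const_add (fun r : ℝ => φ (r : Circ)) t 0
  simp only [add_zero] at this
  rw [← this]
  simp [circDeriv]

lemma IsCk.continuous_circDeriv {φ : Circ → ℝ} (h : IsCk ⊤ φ) :
    Continuous (circDeriv φ) := by
  have h1 : Continuous (circDeriv φ ∘ (QuotientAddGroup.mk : ℝ → Circ)) := by
    have : circDeriv φ ∘ (QuotientAddGroup.mk : ℝ → Circ)
        = deriv (fun r : ℝ => φ (r : Circ)) := by
      funext t
      exact circDeriv_coe t
    rw [this]
    exact ContDiff.continuous_deriv h (by simp)
  exact (QuotientAddGroup.isQuotientMap_mk _).continuous_iff.2 h1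

lemma integrable_smul_Lp {n : ℕ} {ψ : Circ → ℝ} (hψ : Continuous ψ)
    (u : Lp (Amb n) 2 (volume : Measure Circ)) : Integrable (fun x => ψ x • u x) := by
  have hu : Integrable (fun x => u x) (volume : Measure Circ) :=
    MemLp.integrable (q := 2) one_le_two (Lp.memLp u)
  obtain ⟨C, hC⟩ := isCompact_univ.exists_bound_of_continuousOn hψ.continuousOn
  have h1 : ∀ᵐ x ∂(volume : Measure Circ), ‖ψ x‖ ≤ C :=
    Filter.Eventually.of_forall fun x => hC x (mem_univ x)
  have h2 : AEStronglyMeasurable ψ (volume : Measure Circ) := hψ.aestronglyMeasurable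
  refine Integrable.mono' (hu.norm.const_mul C) (h2.smul hu.aestronglyMeasurable) ?_
  filter_upwards [h1] with x hx
  rw [norm_smul]
  gcongr

/-- The Hilbert space in which the Sobolev--Slobodeckij norm is computed: its norm is
`‖(u, w, g)‖² = ‖u‖²_{L²} + ‖w‖²_{L²} + ‖g‖²_{L²(μ)}`. -/
abbrev Triple (n : ℕ) : Type :=
  WithLp 2 (Lp (Amb n) 2 (volume : Measure Circ) ×
    WithLp 2 (Lp (Amb n) 2 (volume : Measure Circ) × Lp (Amb n) 2 mu))

/-- The Sobolev--Slobodeckij space of order `s`, `1 < s < 2`: all `u ∈ L²` that have a weak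
derivative `u' ∈ L²` whose fractional difference of order `s - 1` lies in `L²(μ)`.
An element is recorded as the triple of `u`, `u'` and that fractional difference (the last
two are determined by `u`), so that the norm inherited from `Triple` is
`‖u‖² = ‖u‖²_{L²} + ‖u'‖²_{L²} + ∫∫ |u'(y) - u'(x)|² / dist(y,x)^{2 (s-1)} dμ(x,y)`. -/
noncomputable def sobolevSubmodule (s : ℝ) (n : ℕ) : Submodule ℝ (Triple n) where
  carrier := {T | IsWeakDeriv T.fst T.snd.fst ∧ T.snd.snd =ᵐ[mu] fracDiff (s - 1) T.snd.fst}
  zero_mem' := by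
    constructor
    · intro φ _
      have h : ∀ᵐ x : Circ, (0 : Lp (Amb n) 2 (volume : Measure Circ)) x = 0 :=
        Lp.coeFn_zero _ _ _
      have h1 : ∀ ψ : Circ → ℝ,
          ∫ x, ψ x • (0 : Lp (Amb n) 2 (volume : Measure Circ)) x = 0 := by
        intro ψ
        refine integral_eq_zero_of_ae ?_
        filter_upwards [h] with x hx
        rw [hx, smul_zero]
        rfl
      change ∫ x, circDeriv _ x • (0 : Lp (Amb n) 2 (volume : Measure Circ)) x
        = - ∫ x, _ • (0 : Lp (Amb n) 2 (volume : Measure Circ)) x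
      rw [h1, h1, neg_zero]
    · have h : ∀ᵐ x : Circ, (0 : Lp (Amb n) 2 (volume : Measure Circ)) x = 0 :=
        Lp.coeFn_zero _ _ _
      have h0 : ∀ᵐ p ∂mu, (0 : Lp (Amb n) 2 mu) p = 0 := Lp.coeFn_zero _ _ _
      change (0 : Lp (Amb n) 2 mu) =ᵐ[mu]
        fracDiff (s - 1) (0 : Lp (Amb n) 2 (volume : Measure Circ))
      filter_upwards [h0, ae_fst_mu h, ae_snd_mu h] with p hp h1 h2
      rw [hp, fracDiff, h1, h2, sub_zero, smul_zero]
  add_mem' := by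
    rintro S T ⟨hS, hS'⟩ ⟨hT, hT'⟩
    constructor
    · intro φ hφ
      have key : ∀ (ψ : Circ → ℝ), Continuous ψ →
          ∀ u v : Lp (Amb n) 2 (volume : Measure Circ),
          ∫ x, ψ x • (u + v : Lp (Amb n) 2 (volume : Measure Circ)) x
            = (∫ x, ψ x • u x) + ∫ x, ψ x • v x := by
        intro ψ hψ u v
        rw [← integral_add (integrable_smul_Lp hψ u) (integrable_smul_Lp hψ v)]
        refine integral_congr_ae ?_
        filter_upwards [Lp.coeFn_add u v] with x hx
        rw [hx, Pi.add_apply, smul_add]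
      have e1 := key _ hφ.continuous_circDeriv S.fst T.fst
      have e2 := key _ hφ.continuous S.snd.fst T.snd.fst
      simp only [WithLp.add_fst, WithLp.add_snd]
      rw [e1, e2, hS φ hφ, hT φ hφ]
      abel
    · have h := Lp.coeFn_add S.snd.fst T.snd.fst
      simp only [WithLp.add_snd, WithLp.add_fst]
      filter_upwards [Lp.coeFn_add S.snd.snd T.snd.snd, ae_fst_mu h, ae_snd_mu h, hS', hT']
        with p hp h1 h2 h3 h4
      simp only [fracDiff] at h3 h4 ⊢
      rw [hp, h1, h2]
      simp only [Pi.add_apply]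
      rw [h3, h4, ← smul_add]
      congr 1
      abel
  smul_mem' := by
    rintro c T ⟨hT, hT'⟩
    constructor
    · intro φ hφ
      have key : ∀ (ψ : Circ → ℝ) (u : Lp (Amb n) 2 (volume : Measure Circ)),
          ∫ x, ψ x • (c • u : Lp (Amb n) 2 (volume : Measure Circ)) x
            = c • ∫ x, ψ x • u x := by
        intro ψ u
        rw [← integral_smul]
        refine integral_congr_ae ?_
        filter_upwards [Lp.coeFn_smul c u] with x hx
        simp only [hx, Pi.smul_apply]
        rw [smul_comm]
      simp only [WithLp.smul_fst, WithLp.smul_snd]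
      rw [key, key, hT φ hφ, smul_neg]
    · have h := Lp.coeFn_smul c T.snd.fst
      simp only [WithLp.smul_snd, WithLp.smul_fst]
      filter_upwards [Lp.coeFn_smul c T.snd.snd, ae_fst_mu h, ae_snd_mu h, hT']
        with p hp h1 h2 h3
      simp only [fracDiff] at h3 ⊢
      rw [hp, h1, h2]
      simp only [Pi.smul_apply]
      rw [h3, smul_comm, ← smul_sub]

/-- The Sobolev--Slobodeckij space of order `s` of maps from the circle to `ℝⁿ`. -/
def Sob (s : ℝ) (n : ℕ) : Type := sobolevSubmodule s n

noncomputable instance (s : ℝ) (n : ℕ) : NormedAddCommGroup (Sob s n) :=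
  inferInstanceAs (NormedAddCommGroup (sobolevSubmodule s n))

noncomputable instance (s : ℝ) (n : ℕ) : InnerProductSpace ℝ (Sob s n) :=
  inferInstanceAs (InnerProductSpace ℝ (sobolevSubmodule s n))

variable {s : ℝ} {n : ℕ}

/-- (A representative of) the map `u` itself. -/
noncomputable def Sob.fn (u : Sob s n) : Circ → Amb n := (Subtype.val u : Triple n).fst

/-- (A representative of) the weak derivative `u'`. -/
noncomputable def Sob.der (u : Sob s n) : Circ → Amb n := (Subtype.val u : Triple n).snd.fst

/-- The set of all `γ` in the Sobolev--Slobodeckij space that are embeddings, i.e., whose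
`C¹` representative is an injective immersion (the circle is compact). -/
def embeddings (s : ℝ) (n : ℕ) : Set (Sob s n) :=
  {γ | ∃ g : Circ → Amb n, γ.fn =ᵐ[volume] g ∧ IsCk 1 g ∧ Function.Injective g ∧
    ∀ x, circDeriv g x ≠ 0}

/-- The derivative with respect to arc length, `D_γ u(x) = u'(x) / |γ'(x)|`. -/
noncomputable def arcDeriv (γ u : Sob s n) (x : Circ) : Amb n :=
  ‖γ.der x‖⁻¹ • u.der x

/-- The operator `𝒟_γ u(x) = du(x) dγ(x)^† = (u'(x)/|γ'(x)|) (γ'(x)/|γ'(x)|)ᵀ`. -/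
noncomputable def fullDeriv (γ u : Sob s n) (x : Circ) : Amb n →L[ℝ] Amb n :=
  (innerSL ℝ (‖γ.der x‖⁻¹ • γ.der x)).smulRight (‖γ.der x‖⁻¹ • u.der x)

/-- The operator
`R_γ^s u(x,y) = (u(y) - u(x) - 𝒟_γ u(x) (γ(y) - γ(x))) / |γ(y) - γ(x)|^s`. -/
noncomputable def opR (γ u : Sob s n) (p : Circ × Circ) : Amb n :=
  (‖γ.fn p.2 - γ.fn p.1‖ ^ s)⁻¹ •
    (u.fn p.2 - u.fn p.1 - fullDeriv γ u p.1 (γ.fn p.2 - γ.fn p.1))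

/-- The measure `dμ_γ(x,y) = |γ'(y)| |γ'(x)| dy dx / |γ(y) - γ(x)|`. -/
noncomputable def muGamma (γ : Sob s n) : Measure (Circ × Circ) :=
  (volume.prod volume).withDensity
    (fun p => ENNReal.ofReal (‖γ.der p.2‖ * ‖γ.der p.1‖ / ‖γ.fn p.2 - γ.fn p.1‖))

/-- `∫∫ ⟨R_γ^s u, R_γ^s v⟩ dμ_γ`. -/
noncomputable def B1 (γ u v : Sob s n) : ℝ :=
  ∫ p, ⟪opR γ u p, opR γ v p⟫ ∂(muGamma γ)

/-- `∫∫ |R_γ^s γ|² ⟨(u(y) - u(x)) / |γ(y) - γ(x)|, (v(y) - v(x)) / |γ(y) - γ(x)|⟩ dμ_γ`. -/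
noncomputable def B2 (γ u v : Sob s n) : ℝ :=
  ∫ p, ‖opR γ γ p‖ ^ 2 *
    ⟪‖γ.fn p.2 - γ.fn p.1‖⁻¹ • (u.fn p.2 - u.fn p.1),
      ‖γ.fn p.2 - γ.fn p.1‖⁻¹ • (v.fn p.2 - v.fn p.1)⟫ ∂(muGamma γ)

/-- `∫∫ |R_γ^s γ|² (⟨D_γ u(x), D_γ v(x)⟩ + ⟨D_γ u(y), D_γ v(y)⟩) dμ_γ`. -/
noncomputable def B3 (γ u v : Sob s n) : ℝ :=
  ∫ p, ‖opR γ γ p‖ ^ 2 *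
    (⟪arcDeriv γ u p.1, arcDeriv γ v p.1⟫ + ⟪arcDeriv γ u p.2, arcDeriv γ v p.2⟫)
      ∂(muGamma γ)

/-- The density of the geometric `H¹` product with respect to Lebesgue measure. -/
noncomputable def h1Density (γ u v : Sob s n) (x : Circ) : ℝ :=
  ⟪arcDeriv γ u x, arcDeriv γ v x⟫ * ‖γ.der x‖

/-- The density of the geometric `L²` product with respect to Lebesgue measure. -/
noncomputable def l2Density (γ u v : Sob s n) (x : Circ) : ℝ :=
  ⟪u.fn x, v.fn x⟫ * ‖γ.der x‖

/-- The metric `G_γ(u,v)`. -/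
noncomputable def G (γ u v : Sob s n) : ℝ :=
  2 * B1 γ u v + (2 * s + 1) * B2 γ u v + B3 γ u v
    + (∫ x, h1Density γ u v x) + ∫ x, l2Density γ u v x

/-- The quotient `Λ(γ)(x,y) = dist(y,x) / |γ(y) - γ(x)|`. -/
noncomputable def Lam (γ : Sob s n) (p : Circ × Circ) : ℝ :=
  dist p.2 p.1 / ‖γ.fn p.2 - γ.fn p.1‖

/-- The density of `B1` with respect to `μ`. -/
noncomputable def b1 (γ u v : Sob s n) (p : Circ × Circ) : ℝ :=
  ⟪opR γ u p, opR γ v p⟫ * Lam γ p * ‖γ.der p.1‖ * ‖γ.der p.2‖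

/-- The density of `B2` with respect to `μ`. -/
noncomputable def b2 (γ u v : Sob s n) (p : Circ × Circ) : ℝ :=
  b1 γ γ γ p * ⟪fracDiff 1 u.fn p, fracDiff 1 v.fn p⟫ * Lam γ p ^ 2

/-- The density of `B3` with respect to `μ`. -/
noncomputable def b3 (γ u v : Sob s n) (p : Circ × Circ) : ℝ :=
  b1 γ γ γ p *
    (⟪arcDeriv γ u p.1, arcDeriv γ v p.1⟫ + ⟪arcDeriv γ u p.2, arcDeriv γ v p.2⟫)

/-- The map `(γ,u,v) ↦ b γ u v` is a smooth map from `M × H^s × H^s` to `L¹(μ)`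
(in particular, `b γ u v` is `μ`-integrable for `γ ∈ M`). -/
def SmoothIntoL1 (b : Sob s n → Sob s n → Sob s n → Circ × Circ → ℝ) : Prop :=
  ∃ F : Sob s n × Sob s n × Sob s n → Lp ℝ 1 mu,
    ContDiffOn ℝ ∞ F (embeddings s n ×ˢ univ) ∧
    ∀ γ ∈ embeddings s n, ∀ u v : Sob s n, F (γ, u, v) =ᵐ[mu] b γ u v

end TangentPoint

open TangentPoint

namespace TangentPoint

/-! ### Powers of positive functions as a smooth map on `L^∞` -/

section Power

variable {α : Type*} {m : MeasurableSpace α} {μ : Measure α}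

/-! The metric is assembled from a few bounded linear operators on `H^s` and from real powers of
lengths; each piece is smooth, and Hölder products of smooth maps are smooth.

Since `s - 1 > 1/2`, a fractional Morrey embedding (`exists_continuous_rep`, by Fourier series)
bounds `u'` uniformly by `‖u‖`. So `H^s` embeds in `C¹`, the maps `u ↦ u'(x)`, `u ↦ u'(y)` and `u ↦
(u(y) - u(x)) / d` are bounded into `L^∞(μ)`, and embeddings form an open set because their
bi-Lipschitz and speed bounds survive small `C¹` perturbations. A weighted Hardy inequality
(`hardy`) bounds the Taylor remainder `Tu = (u(y) - u(x) - (y - x) u'(x)) / d^s` in `L²(μ)` by the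
Slobodeckij seminorm of `u'`.

The decisive identity is `opR_eq`. Because `𝒟_γ u(x)` maps `γ'(x)` to `u'(x)`, the linear parts
cancel, and `R_γ u` equals `|Qγ|^{-s} (Tu - |γ'(x)|^{-2} ⟨γ'(x), Tγ⟩ u'(x))` with `Qγ = (γ(y) -
γ(x)) / d`. Only the powers of `|Qγ|` and `|γ'|` are neither linear nor polynomial in `γ`. On
embeddings these lengths are bounded above and away from zero, and `a ↦ a^p` is smooth on such
functions in `L^∞` (`contDiffOn_powLp`).

Hence `γ ↦ R_γ` is smooth into the bounded operators from `H^s` to `L²(μ)`. The densities are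
products of type `L^∞ · L² · L²` or `L¹ · L^∞ · L^∞`, so they give smooth families of bounded
bilinear forms with values in `L¹`. Evaluation yields joint smoothness in `(γ, u, v)`; integration,
which is bounded and linear on `L¹`, yields smoothness of `G`. -/

lemma Lp_top_ae_norm_le {E : Type*} [NormedAddCommGroup E] (f : Lp E ∞ μ) :
    ∀ᵐ x ∂μ, ‖f x‖ ≤ ‖f‖ := by
  have h := ae_le_eLpNormEssSup (f := f) (μ := μ)
  filter_upwards [h] with x hx
  have h2 : ‖f x‖ₑ ≤ ‖f‖ₑ := by rwa [Lp.enorm_def, eLpNorm_exponent_top]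
  simpa using (enorm_le_iff_norm_le (x := f x) (y := f)).1 h2

lemma Lp_top_norm_le {E : Type*} [NormedAddCommGroup E] (f : Lp E ∞ μ) {C : ℝ} (hC : 0 ≤ C)
    (h : ∀ᵐ x ∂μ, ‖f x‖ ≤ C) : ‖f‖ ≤ C := by
  rw [Lp.norm_def, eLpNorm_exponent_top]
  refine ENNReal.toReal_le_of_le_ofReal hC (essSup_le_of_ae_le _ ?_)
  filter_upwards [h] with x hx
  rw [← ofReal_norm]
  exact ENNReal.ofReal_le_ofReal hx

/-- The essentially bounded functions that are bounded below by a positive constant. -/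
def posSet (μ : Measure α) : Set (Lp ℝ ∞ μ) := {a | ∃ c > 0, ∀ᵐ x ∂μ, c ≤ a x}

lemma isOpen_posSet : IsOpen (posSet μ) := by
  rw [Metric.isOpen_iff]
  rintro a ⟨c, hc, ha⟩
  refine ⟨c / 2, half_pos hc, fun b hb => ⟨c / 2, half_pos hc, ?_⟩⟩
  rw [Metric.mem_ball, dist_eq_norm] at hb
  filter_upwards [ha, Lp_top_ae_norm_le (b - a), Lp.coeFn_sub b a] with x h1 h2 h3
  rw [h3, Pi.sub_apply, Real.norm_eq_abs] at h2
  linarith [(abs_le.1 h2).1]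

lemma memLp_rpow {a : Lp ℝ ∞ μ} (ha : a ∈ posSet μ) (p : ℝ) :
    MemLp (fun x => a x ^ p) ∞ μ := by
  obtain ⟨c, hc, ha⟩ := ha
  have hcont : ContinuousOn (fun t : ℝ => t ^ p) (Icc c ‖a‖) := fun t ht =>
    (Real.continuousAt_rpow_const t p (Or.inl (by linarith [ht.1]))).continuousWithinAt
  obtain ⟨C, hC⟩ := isCompact_Icc.exists_bound_of_continuousOn hcont
  refine memLp_top_of_bound
    ((Lp.aestronglyMeasurable a).aemeasurable.pow_const p).aestronglyMeasurable C ?_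
  filter_upwards [ha, Lp_top_ae_norm_le a] with x h1 h2
  exact hC _ ⟨h1, (le_abs_self _).trans h2⟩

open Classical in
/-- The superposition operator `a ↦ a ^ p` on essentially bounded functions. -/
noncomputable def powLp (p : ℝ) (a : Lp ℝ ∞ μ) : Lp ℝ ∞ μ :=
  if h : MemLp (fun x => a x ^ p) ∞ μ then h.toLp else 0

lemma coeFn_powLp {a : Lp ℝ ∞ μ} (ha : a ∈ posSet μ) (p : ℝ) :
    powLp p a =ᵐ[μ] fun x => a x ^ p := by
  rw [powLp, dif_pos (memLp_rpow ha p)]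
  exact MemLp.coeFn_toLp _

/-- The mean value inequality is applied to `τ ^ p - p * t ^ (p - 1) * τ`, whose derivative is small
near `t` by uniform continuity on a compact interval. The point is that `δ` does not depend on `t`.
-/
lemma rpow_taylor {c C ε : ℝ} (hc : 0 < c) (hε : 0 < ε) (p : ℝ) :
    ∃ δ > 0, ∀ t ∈ Icc c C, ∀ h : ℝ, |h| ≤ δ →
      |(t + h) ^ p - t ^ p - p * t ^ (p - 1) * h| ≤ ε * |h| := by
  have hcont : ContinuousOn (fun t : ℝ => p * t ^ (p - 1)) (Icc (c / 2) (C + 1)) := fun t ht =>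
    ((Real.continuousAt_rpow_const t (p - 1)
      (Or.inl (by linarith [ht.1]))).const_mul p).continuousWithinAt
  have hu := isCompact_Icc.uniformContinuousOn_of_continuous hcont
  rw [Metric.uniformContinuousOn_iff_le] at hu
  obtain ⟨δ, hδ, H⟩ := hu ε hε
  -- The caps `c / 2` and `1` keep the segment from `t` to `t + h` inside `Icc (c / 2) (C + 1)`.
  refine ⟨min δ (min (c / 2) 1), by positivity, fun t ht h hh => ?_⟩
  have h1 : |h| ≤ δ := hh.trans (min_le_left _ _)
  have h2 : |h| ≤ c / 2 := hh.trans ((min_le_right _ _).trans (min_le_left _ _))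
  have h3 : |h| ≤ 1 := hh.trans ((min_le_right _ _).trans (min_le_right _ _))
  have hmem : ∀ τ ∈ uIcc t (t + h), |τ - t| ≤ |h| := fun τ hτ => by
    simpa using abs_sub_left_of_mem_uIcc hτ
  have hmem2 : ∀ τ ∈ uIcc t (t + h), τ ∈ Icc (c / 2) (C + 1) := fun τ hτ => by
    have := abs_le.1 (hmem τ hτ)
    constructor <;> linarith [ht.1, ht.2]
  have key := (convex_uIcc t (t + h)).norm_image_sub_le_of_norm_hasDerivWithin_le
    (f := fun τ => τ ^ p - p * t ^ (p - 1) * τ)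
    (f' := fun τ => p * τ ^ (p - 1) - p * t ^ (p - 1)) (C := ε) (x := t) (y := t + h)
    (fun τ hτ => by
      have hd := Real.hasDerivAt_rpow_const (x := τ) (p := p)
        (Or.inl (by linarith [(hmem2 τ hτ).1]))
      simpa using (hd.fun_sub ((hasDerivAt_id τ).const_mul (p * t ^ (p - 1)))).hasDerivWithinAt)
    (fun τ hτ => by
      have := H τ (hmem2 τ hτ) t (hmem2 t left_mem_uIcc) (by
        rw [Real.dist_eq]; exact (hmem τ hτ).trans h1)
      simpa [Real.dist_eq] using this) left_mem_uIcc right_mem_uIcc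
  simp only [Real.norm_eq_abs, add_sub_cancel_left] at key
  convert key using 2
  ring

/-- Pointwise multiplication of essentially bounded functions. -/
noncomputable def mulLp (μ : Measure α) : Lp ℝ ∞ μ →L[ℝ] Lp ℝ ∞ μ →L[ℝ] Lp ℝ ∞ μ :=
  (ContinuousLinearMap.mul ℝ ℝ).holderL μ ∞ ∞ ∞

lemma coeFn_mulLp (a b : Lp ℝ ∞ μ) : mulLp μ a b =ᵐ[μ] fun x => a x * b x :=
  ContinuousLinearMap.coeFn_holder (r := ∞) (ContinuousLinearMap.mul ℝ ℝ) a b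

/-- Almost all values of `a` lie in one compact interval `Icc c ‖a‖` of positive numbers, so the
scalar Taylor estimate holds almost everywhere with a single `δ`, which is a Fréchet estimate in the
sup norm. As `posSet` is open, the default value of `powLp` plays no role near `a`. -/
lemma hasFDerivAt_powLp {a : Lp ℝ ∞ μ} (ha : a ∈ posSet μ) (p : ℝ) :
    HasFDerivAt (powLp p) (mulLp μ (p • powLp (p - 1) a)) a := by
  rw [hasFDerivAt_iff_isLittleO_nhds_zero, Asymptotics.isLittleO_iff]
  intro ε hε
  have hopen := isOpen_posSet.mem_nhds ha
  obtain ⟨c, hc, hac⟩ := id ha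
  obtain ⟨δ, hδ, H⟩ := rpow_taylor (C := ‖a‖) hc hε p
  have h1 : ∀ᶠ h : Lp ℝ ∞ μ in nhds 0, a + h ∈ posSet μ := by
    have : Filter.Tendsto (fun h : Lp ℝ ∞ μ => a + h) (nhds 0) (nhds a) := by
      simpa using (show Continuous fun h : Lp ℝ ∞ μ => a + h by fun_prop).tendsto 0
    exact this hopen
  filter_upwards [h1, Metric.closedBall_mem_nhds (0 : Lp ℝ ∞ μ) hδ] with h hh hball
  rw [mem_closedBall_zero_iff] at hball
  refine Lp_top_norm_le _ (by positivity) ?_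
  filter_upwards [hac, Lp_top_ae_norm_le a, Lp_top_ae_norm_le h, coeFn_powLp ha p,
    coeFn_powLp ha (p - 1), coeFn_powLp hh p, Lp.coeFn_add a h,
    Lp.coeFn_sub (powLp p (a + h) - powLp p a) (mulLp μ (p • powLp (p - 1) a) h),
    Lp.coeFn_sub (powLp p (a + h)) (powLp p a), coeFn_mulLp (p • powLp (p - 1) a) h,
    Lp.coeFn_smul p (powLp (p - 1) a)] with x e1 e2 e3 e4 e5 e6 e7 e8 e9 e10 e11
  rw [e8, Pi.sub_apply, e9, Pi.sub_apply, e6, e7, e4, e10, e11, Pi.smul_apply, e5, Pi.add_apply,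
    smul_eq_mul, Real.norm_eq_abs]
  exact (H _ ⟨e1, (le_abs_self _).trans e2⟩ _ (e3.trans hball)).trans (by gcongr; exact e3)

/-- The derivative is multiplication by another power, `p • a ^ (p - 1)`, so smoothness bootstraps;
the induction must therefore run over all exponents at once. -/
lemma contDiffOn_powLp (p : ℝ) : ContDiffOn ℝ ∞ (powLp p) (posSet μ) := by
  rw [contDiffOn_infty]
  intro k
  induction k generalizing p with
  | zero =>
    exact contDiffOn_zero.2 fun a ha => (hasFDerivAt_powLp ha p).continuousAt.continuousWithinAt
  | succ k ih =>
    push_cast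
    rw [contDiffOn_succ_iff_fderiv_of_isOpen isOpen_posSet]
    refine ⟨fun a ha => (hasFDerivAt_powLp ha p).differentiableAt.differentiableWithinAt,
      by simp, ?_⟩
    refine ((mulLp μ).contDiff.comp_contDiffOn ((ih (p - 1)).const_smul p)).congr fun a ha => ?_
    exact (hasFDerivAt_powLp ha p).fderiv

end Power

/-! ### Smooth families of bounded bilinear maps -/

section Bilinear

variable {E F₁ F₂ F : Type*} [NormedAddCommGroup E] [NormedSpace ℝ E]
  [NormedAddCommGroup F₁] [NormedSpace ℝ F₁] [NormedAddCommGroup F₂] [NormedSpace ℝ F₂]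
  [NormedAddCommGroup F] [NormedSpace ℝ F]

/-- The bilinear map `(u, v) ↦ H (S u) (T v)`. -/
noncomputable def bilinComp (H : F₁ →L[ℝ] F₂ →L[ℝ] F) (S : E →L[ℝ] F₁) (T : E →L[ℝ] F₂) :
    E →L[ℝ] E →L[ℝ] F :=
  ((ContinuousLinearMap.compL ℝ E F₂ F).flip T).comp (H.comp S)

/-- Composition of operators is itself bounded bilinear, so smoothness here is in operator norm, not
only after evaluation at `u` and `v`. -/
lemma contDiffOn_bilinComp {X : Type*} [NormedAddCommGroup X] [NormedSpace ℝ X] {M : Set X}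
    (H : F₁ →L[ℝ] F₂ →L[ℝ] F) {S : X → E →L[ℝ] F₁} {T : X → E →L[ℝ] F₂}
    (hS : ContDiffOn ℝ ∞ S M) (hT : ContDiffOn ℝ ∞ T M) :
    ContDiffOn ℝ ∞ (fun γ => bilinComp H (S γ) (T γ)) M := by
  unfold bilinComp
  exact ((ContinuousLinearMap.compL ℝ E F₂ F).flip.contDiff.comp_contDiffOn hT).clm_comp
    (contDiffOn_const.clm_comp hS)

lemma contDiffOn_postcomp {X : Type*} [NormedAddCommGroup X] [NormedSpace ℝ X] {M : Set X}
    (L : F₁ →L[ℝ] F) {β : X → E →L[ℝ] E →L[ℝ] F₁} (hβ : ContDiffOn ℝ ∞ β M) :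
    ContDiffOn ℝ ∞ (fun γ => ((ContinuousLinearMap.compL ℝ E F₁ F) L).comp (β γ)) M :=
  contDiffOn_const.clm_comp hβ

end Bilinear

/-! ### Fourier coefficients and the Slobodeckij seminorm -/

section Fourier

/-- `fourierCoeff` integrates against normalized Haar measure, which is Lebesgue measure because the
period is one. -/
lemma volume_eq_haar : (volume : Measure Circ) = AddCircle.haarAddCircle := by
  simp [AddCircle.volume_eq_smul_haarAddCircle]

lemma hasSum_sq_fourierCoeff_of_memLp {f : Circ → ℂ} (hf : MemLp f 2 AddCircle.haarAddCircle) :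
    HasSum (fun k => ‖fourierCoeff f k‖ ^ 2) (∫ x, ‖f x‖ ^ 2 ∂AddCircle.haarAddCircle) := by
  have h := hasSum_sq_fourierCoeff hf.toLp
  have e1 : fourierCoeff hf.toLp = fourierCoeff f :=
    fourierCoeff_congr_ae hf.coeFn_toLp
  rw [e1] at h
  convert h using 1
  exact integral_congr_ae (by filter_upwards [hf.coeFn_toLp] with x hx; rw [hx])

lemma tsum_enorm_sq_fourierCoeff_haar {f : Circ → ℂ} (hf : MemLp f 2 AddCircle.haarAddCircle) :
    ∑' k, ‖fourierCoeff f k‖ₑ ^ 2 = ∫⁻ x, ‖f x‖ₑ ^ 2 ∂AddCircle.haarAddCircle := by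
  have h := hasSum_sq_fourierCoeff_of_memLp hf
  have hi : Integrable (fun t => ‖f t‖ ^ 2) AddCircle.haarAddCircle := hf.norm.integrable_sq
  calc ∑' k, ‖fourierCoeff f k‖ₑ ^ 2 = ∑' k, ENNReal.ofReal (‖fourierCoeff f k‖ ^ 2) := by
        congr 1 with k
        rw [ENNReal.ofReal_pow (norm_nonneg _), ofReal_norm]
    _ = ENNReal.ofReal (∫ t, ‖f t‖ ^ 2 ∂AddCircle.haarAddCircle) := by
        rw [← ENNReal.ofReal_tsum_of_nonneg (fun _ => by positivity) h.summable, h.tsum_eq]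
    _ = ∫⁻ t, ENNReal.ofReal (‖f t‖ ^ 2) ∂AddCircle.haarAddCircle :=
        ofReal_integral_eq_lintegral_ofReal hi (.of_forall fun _ => by positivity)
    _ = _ := by
        congr 1 with x
        rw [ENNReal.ofReal_pow (norm_nonneg _), ofReal_norm]

lemma tsum_enorm_sq_fourierCoeff {f : Circ → ℂ} (hf : MemLp f 2 volume) :
    ∑' k, ‖fourierCoeff f k‖ₑ ^ 2 = ∫⁻ x, ‖f x‖ₑ ^ 2 := by
  rw [volume_eq_haar] at hf ⊢
  exact tsum_enorm_sq_fourierCoeff_haar hf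

lemma fourierCoeff_translate (f : Circ → ℂ) (h : Circ) (k : ℤ) :
    fourierCoeff (fun x => f (x + h)) k = fourier k h * fourierCoeff f k := by
  unfold fourierCoeff
  have := integral_add_right_eq_self (μ := (AddCircle.haarAddCircle : Measure Circ))
    (fun x => fourier (-k) (x - h) • f x) h
  simp only [add_sub_cancel_right] at this
  rw [this, ← integral_const_mul]
  congr 1
  ext x
  rw [sub_eq_add_neg, fourier_apply, fourier_apply, fourier_apply]
  simp only [smul_add, AddCircle.toCircle_add, smul_neg, neg_smul, neg_neg, Circle.coe_mul,
    smul_eq_mul]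
  ring

lemma memLp_translate {f : Circ → ℂ} (hf : MemLp f 2 volume) (h : Circ) :
    MemLp (fun x => f (x + h)) 2 volume :=
  hf.comp_measurePreserving (measurePreserving_add_right volume h)

/-- Parseval: translation by `h` multiplies the `k`-th coefficient by the character value `fourier k
h`. -/
lemma lintegral_translate_sub {f : Circ → ℂ} (hf : MemLp f 2 volume) (h : Circ) :
    ∫⁻ x, ‖f (x + h) - f x‖ₑ ^ 2
      = ∑' k : ℤ, ‖fourier k h - 1‖ₑ ^ 2 * ‖fourierCoeff f k‖ₑ ^ 2 := by
  have hh := memLp_translate hf h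
  have hi : Integrable f AddCircle.haarAddCircle := by
    rw [← volume_eq_haar]; exact hf.integrable one_le_two
  have hhi : Integrable (fun x => f (x + h)) AddCircle.haarAddCircle := by
    rw [← volume_eq_haar]; exact hh.integrable one_le_two
  have := tsum_enorm_sq_fourierCoeff (hh.sub hf)
  simp only [Pi.sub_apply] at this
  rw [← this]
  congr 1
  ext k
  have e : fourierCoeff ((fun x => f (x + h)) - f) k = (fourier k h - 1) * fourierCoeff f k := by
    rw [sub_eq_add_neg, fourierCoeff.add hhi hi.neg]
    have : fourierCoeff (-f) k = - fourierCoeff f k := by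
      simpa using fourierCoeff.const_smul f (-1) k
    simp only [Pi.add_apply]
    rw [this, fourierCoeff_translate]
    ring
  rw [e, enorm_mul, mul_pow]

/-- `|exp(2πiθ) - 1| = 2 |sin(πθ)| ≥ 4 |θ|` for `|θ| ≤ 1/2`, by Jordan's inequality. -/
lemma one_le_norm_fourier_sub_one {k : ℤ} {t : ℝ} (ht : 1 / 4 ≤ |k * t|) (ht' : |k * t| ≤ 1 / 2) :
    1 ≤ ‖(fourier k (t : Circ) : ℂ) - 1‖ := by
  rw [fourier_coe_apply]
  have e : (2 * Real.pi * Complex.I * k * t / (1 : ℝ) : ℂ)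
      = Complex.I * ((2 * Real.pi * (k * t) : ℝ) : ℂ) := by
    push_cast; ring
  rw [e, Complex.norm_exp_I_mul_ofReal_sub_one, norm_mul]
  have e2 : 2 * Real.pi * (k * t) / 2 = Real.pi * (k * t) := by ring
  rw [e2]
  have hpi := Real.pi_pos
  have h1 : |Real.pi * (k * t)| = Real.pi * |k * t| := by rw [abs_mul, abs_of_pos hpi]
  have h2 := Real.mul_abs_le_abs_sin (x := Real.pi * (k * t)) (by rw [h1]; nlinarith)
  rw [h1] at h2
  have h3 : 2 / Real.pi * (Real.pi * |k * t|) = 2 * |k * t| := by field_simp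
  rw [h3] at h2
  simp only [Real.norm_eq_abs, abs_two]
  linarith

lemma norm_coe_circ {t : ℝ} (ht : |t| ≤ 1 / 2) : ‖(t : Circ)‖ = |t| :=
  (AddCircle.norm_coe_eq_abs_iff 1 one_ne_zero).2 (by simpa using ht)

/-- With `K = |k|`, the shell `1/(4K) < h ≤ 1/(2K)` suffices: the integrand there is at least
`(2K)^(1+2σ)` and the length is `1/(4K)`. The product is `2^(2σ)/2 · K^(2σ)`, and `2σ > 1` absorbs
the constant. -/
lemma ofReal_abs_rpow_le_lintegral {σ : ℝ} (hσ : 1 / 2 < σ) (k : ℤ) :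
    ENNReal.ofReal (|(k : ℝ)| ^ (2 * σ)) ≤
      ∫⁻ h : Circ, ENNReal.ofReal (‖h‖ ^ (-(1 + 2 * σ))) * ‖(fourier k h : ℂ) - 1‖ₑ ^ 2 := by
  rcases eq_or_ne k 0 with rfl | hk
  · rw [Int.cast_zero, abs_zero, Real.zero_rpow (by linarith), ENNReal.ofReal_zero]
    exact zero_le
  set K : ℝ := |(k : ℝ)| with hK
  have hK1 : 1 ≤ K := by
    rw [hK, ← Int.cast_abs]
    exact_mod_cast Int.one_le_abs hk
  have hK0 : 0 < K := by linarith
  rw [← AddCircle.lintegral_preimage 1 (-1 / 2)]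
  have hsub : Ioc (1 / (4 * K)) (1 / (2 * K)) ⊆ Ioc (-1 / 2 : ℝ) (-1 / 2 + 1) := by
    intro t ht
    have h1 : 0 < 1 / (4 * K) := by positivity
    have h2 : 1 / (2 * K) ≤ 1 / 2 := one_div_le_one_div_of_le two_pos (by linarith)
    constructor <;> linarith [ht.1, ht.2]
  refine le_trans ?_ (lintegral_mono_set hsub)
  have hpt : ∀ t ∈ Ioc (1 / (4 * K)) (1 / (2 * K)),
      ENNReal.ofReal ((2 * K) ^ (1 + 2 * σ)) ≤
        ENNReal.ofReal (‖(t : Circ)‖ ^ (-(1 + 2 * σ))) * ‖(fourier k (t : Circ) : ℂ) - 1‖ₑ ^ 2 := by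
    intro t ht
    have h0 : 0 < t := lt_trans (by positivity) ht.1
    have h2 : t ≤ 1 / 2 :=
      ht.2.trans (one_div_le_one_div_of_le two_pos (by linarith))
    have h3 : |(k : ℝ) * t| = K * t := by rw [abs_mul, abs_of_pos h0]
    have h4 : (1 : ℝ≥0∞) ≤ ‖(fourier k (t : Circ) : ℂ) - 1‖ₑ := by
      rw [← ofReal_norm, ENNReal.one_le_ofReal]
      refine one_le_norm_fourier_sub_one ?_ ?_ <;> rw [h3]
      · have := ht.1.le
        rw [div_le_iff₀ (by positivity)] at this
        linarith
      · have := ht.2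
        rw [le_div_iff₀ (by positivity)] at this
        linarith
    have h5 : (2 * K) ^ (1 + 2 * σ) ≤ ‖(t : Circ)‖ ^ (-(1 + 2 * σ)) := by
      rw [norm_coe_circ (by rwa [abs_of_pos h0]), abs_of_pos h0, Real.rpow_neg h0.le,
        ← Real.inv_rpow h0.le]
      refine Real.rpow_le_rpow (by positivity) ?_ (by linarith)
      rw [le_inv_comm₀ (by positivity) h0, ← one_div]
      exact ht.2
    calc _ = ENNReal.ofReal ((2 * K) ^ (1 + 2 * σ)) * 1 ^ 2 := by simp
      _ ≤ _ := by gcongr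
  refine le_trans ?_ (setLIntegral_mono_ae' measurableSet_Ioc (.of_forall hpt))
  rw [setLIntegral_const, Real.volume_Ioc, ← ENNReal.ofReal_mul (by positivity)]
  refine ENNReal.ofReal_le_ofReal ?_
  have e1 : 1 / (2 * K) - 1 / (4 * K) = 1 / (2 * (2 * K)) := by field_simp; norm_num
  rw [e1, Real.rpow_add (by positivity), Real.rpow_one, Real.mul_rpow two_pos.le hK0.le]
  have e2 : (2 : ℝ) ≤ 2 ^ (2 * σ) := by
    conv_lhs => rw [← Real.rpow_one 2]
    exact Real.rpow_le_rpow_of_exponent_le one_le_two (by linarith)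
  have e3 : 2 * K * (2 ^ (2 * σ) * K ^ (2 * σ)) * (1 / (2 * (2 * K)))
      = 2 ^ (2 * σ) / 2 * K ^ (2 * σ) := by
    field_simp
  rw [e3]
  exact le_mul_of_one_le_left (by positivity) (by linarith)

/-- The square of the Slobodeckij seminorm of order `σ`. -/
noncomputable def slobSq {F : Type*} [NormedAddCommGroup F] (σ : ℝ) (f : Circ → F) : ℝ≥0∞ :=
  ∫⁻ x, ∫⁻ y, ENNReal.ofReal (dist y x ^ (-(1 + 2 * σ))) * ‖f y - f x‖ₑ ^ 2

lemma measurable_kernel (τ : ℝ) : Measurable fun h : Circ => ENNReal.ofReal (‖h‖ ^ τ) :=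
  (measurable_norm.pow_const τ).ennreal_ofReal

lemma slobSq_eq {F : Type*} [NormedAddCommGroup F] [MeasurableSpace F] [BorelSpace F]
    [SecondCountableTopology F] {f : Circ → F} (σ : ℝ) (hf : Measurable f) :
    slobSq σ f = ∫⁻ h : Circ, ∫⁻ x,
      ENNReal.ofReal (‖h‖ ^ (-(1 + 2 * σ))) * ‖f (x + h) - f x‖ₑ ^ 2 := by
  have e : slobSq σ f = ∫⁻ x, ∫⁻ h : Circ,
      ENNReal.ofReal (‖h‖ ^ (-(1 + 2 * σ))) * ‖f (x + h) - f x‖ₑ ^ 2 := by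
    unfold slobSq
    congr 1
    ext x
    rw [← lintegral_add_left_eq_self _ x]
    congr 1
    ext y
    rw [dist_eq_norm, add_sub_cancel_left]
  rw [e]
  refine lintegral_lintegral_swap (Measurable.aemeasurable ?_)
  have h1 : Measurable fun p : Circ × Circ => ENNReal.ofReal (‖p.2‖ ^ (-(1 + 2 * σ))) :=
    (measurable_kernel (-(1 + 2 * σ))).comp measurable_snd
  have h2 : Measurable fun p : Circ × Circ => f (p.1 + p.2) - f p.1 :=
    (hf.comp (measurable_fst.add measurable_snd)).sub (hf.comp measurable_fst)
  exact h1.mul (h2.enorm.pow_const 2)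

/-- Parseval at each shift `h`, then exchange of sum and integral, reduces the seminorm to a
separate multiplier bound for each frequency. -/
lemma tsum_rpow_mul_fourierCoeff_le {σ : ℝ} (hσ : 1 / 2 < σ) {f : Circ → ℂ} (hfm : Measurable f)
    (hf : MemLp f 2 volume) :
    ∑' k : ℤ, ENNReal.ofReal (|(k : ℝ)| ^ (2 * σ)) * ‖fourierCoeff f k‖ₑ ^ 2 ≤ slobSq σ f := by
  have e : slobSq σ f = ∫⁻ h : Circ, ∑' k : ℤ,
      ENNReal.ofReal (‖h‖ ^ (-(1 + 2 * σ))) * ‖(fourier k h : ℂ) - 1‖ₑ ^ 2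
        * ‖fourierCoeff f k‖ₑ ^ 2 := by
    rw [slobSq_eq σ hfm]
    congr 1
    ext h
    rw [lintegral_const_mul' _ _ ENNReal.ofReal_ne_top, lintegral_translate_sub hf,
      ← ENNReal.tsum_mul_left]
    simp only [mul_assoc]
  rw [e, lintegral_tsum]
  · refine ENNReal.tsum_le_tsum fun k => ?_
    rw [lintegral_mul_const' _ _ (by simp)]
    gcongr
    exact ofReal_abs_rpow_le_lintegral hσ k
  · intro k
    have : Measurable fun h : Circ => ‖(fourier k h : ℂ) - 1‖ₑ :=
      (by fun_prop : Continuous fun h : Circ => (fourier k h : ℂ) - 1).measurable.enorm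
    exact (((measurable_kernel _).mul (this.pow_const 2)).mul_const _).aemeasurable

/-- Cauchy–Schwarz against the weight `1 + |k|^(2σ)`, whose reciprocal is summable because `2σ > 1`.
-/
lemma tsum_enorm_fourierCoeff_sq_le {σ : ℝ} (hσ : 1 / 2 < σ) :
    ∃ C : ℝ, 0 ≤ C ∧ ∀ f : Circ → ℂ, Measurable f → MemLp f 2 volume →
      (∑' k : ℤ, ‖fourierCoeff f k‖ₑ) ^ 2 ≤
        ENNReal.ofReal C * ((∫⁻ x, ‖f x‖ₑ ^ 2) + slobSq σ f) := by
  let w : ℤ → ℝ := fun k => 1 + |(k : ℝ)| ^ (2 * σ)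
  have hw : ∀ k, 1 ≤ w k := fun k => by
    simp only [w]
    linarith [Real.rpow_nonneg (abs_nonneg (k : ℝ)) (2 * σ)]
  have hw0 : ∀ k, 0 < w k := fun k => one_pos.trans_le (hw k)
  have hsum : Summable fun k => (w k)⁻¹ := by
    -- The comparison fails at `k = 0`, where `0 ^ (-(2σ)) = 0`, so it is required only off a finite
    -- set.
    refine (Real.summable_abs_int_rpow (b := 2 * σ) (by linarith)).of_norm_bounded_eventually ?_
    rw [Filter.eventually_cofinite]
    refine (finite_singleton (0 : ℤ)).subset fun k hk => ?_
    by_contra hk0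
    refine hk ?_
    have hk1 : 0 < |(k : ℝ)| := abs_pos.2 (by exact_mod_cast hk0)
    rw [Real.norm_of_nonneg (inv_nonneg.2 (hw0 k).le), Real.rpow_neg hk1.le]
    exact inv_anti₀ (Real.rpow_pos_of_pos hk1 _) (by simp [w])
  refine ⟨∑' k, (w k)⁻¹, tsum_nonneg fun k => (inv_nonneg.2 (hw0 k).le), fun f hfm hf => ?_⟩
  have hCS := ENNReal.lintegral_mul_le_Lp_mul_Lq (Measure.count : Measure ℤ)
    (Real.HolderConjugate.two_two) (f := fun k => ENNReal.ofReal (√(w k)) * ‖fourierCoeff f k‖ₑ)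
    (g := fun k => ENNReal.ofReal (√(w k)⁻¹)) measurable_from_top.aemeasurable
    measurable_from_top.aemeasurable
  simp only [lintegral_count, Pi.mul_apply] at hCS
  have e1 : ∀ k, ENNReal.ofReal (√(w k)) * ‖fourierCoeff f k‖ₑ * ENNReal.ofReal (√(w k)⁻¹)
      = ‖fourierCoeff f k‖ₑ := fun k => by
    rw [mul_right_comm, ← ENNReal.ofReal_mul (Real.sqrt_nonneg _), ← Real.sqrt_mul (hw0 k).le,
      mul_inv_cancel₀ (hw0 k).ne']
    simp
  have e2 : ∀ k, ENNReal.ofReal (√(w k)⁻¹) ^ (2 : ℝ) = ENNReal.ofReal (w k)⁻¹ := fun k => by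
    rw [ENNReal.rpow_two, ← ENNReal.ofReal_pow (Real.sqrt_nonneg _),
      Real.sq_sqrt (inv_nonneg.2 (hw0 k).le)]
  have e3 : ∀ k, (ENNReal.ofReal (√(w k)) * ‖fourierCoeff f k‖ₑ) ^ (2 : ℝ)
      = ‖fourierCoeff f k‖ₑ ^ 2
        + ENNReal.ofReal (|(k : ℝ)| ^ (2 * σ)) * ‖fourierCoeff f k‖ₑ ^ 2 := fun k => by
    rw [ENNReal.rpow_two, mul_pow, ← ENNReal.ofReal_pow (Real.sqrt_nonneg _),
      Real.sq_sqrt (hw0 k).le, ENNReal.ofReal_add zero_le_one (by positivity), add_mul]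
    simp
  simp only [e1, e2, e3] at hCS
  rw [ENNReal.tsum_add, tsum_enorm_sq_fourierCoeff hf,
    ← ENNReal.ofReal_tsum_of_nonneg (fun k => (inv_nonneg.2 (hw0 k).le)) hsum] at hCS
  calc _ ≤ _ := pow_le_pow_left' hCS 2
    _ = ((∫⁻ x, ‖f x‖ₑ ^ 2)
          + ∑' k : ℤ, ENNReal.ofReal (|(k : ℝ)| ^ (2 * σ)) * ‖fourierCoeff f k‖ₑ ^ 2)
          * ENNReal.ofReal (∑' k, (w k)⁻¹) := by
        rw [mul_pow, ← ENNReal.rpow_two, ← ENNReal.rpow_two, ← ENNReal.rpow_mul,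
          ← ENNReal.rpow_mul]
        norm_num
    _ ≤ _ := by
        rw [mul_comm]
        gcongr
        exact tsum_rpow_mul_fourierCoeff_le hσ hfm hf

/-- A square integrable function is determined by its Fourier coefficients. -/
lemma ae_eq_of_fourierCoeff_eq {f g : Circ → ℂ} (hf : MemLp f 2 volume) (hg : MemLp g 2 volume)
    (h : ∀ k, fourierCoeff f k = fourierCoeff g k) : f =ᵐ[volume] g := by
  rw [volume_eq_haar] at *
  have : hf.toLp = hg.toLp := by
    apply fourierBasis.repr.injective
    ext k
    rw [fourierBasis_repr, fourierBasis_repr, fourierCoeff_congr_ae hf.coeFn_toLp,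
      fourierCoeff_congr_ae hg.coeFn_toLp, h]
  exact (MemLp.toLp_eq_toLp_iff hf hg).1 this

/-- A square integrable function with summable Fourier coefficients is continuous. -/
lemma exists_continuous_of_summable {f : Circ → ℂ} (hf : MemLp f 2 volume)
    (h : Summable fun k => ‖fourierCoeff f k‖) :
    ∃ g : Circ → ℂ, Continuous g ∧ f =ᵐ[volume] g ∧
      ∀ x, ‖g x‖ ≤ ∑' k, ‖fourierCoeff f k‖ := by
  have hn : ∀ k : ℤ, ‖fourierCoeff f k • (fourier k : C(Circ, ℂ))‖ = ‖fourierCoeff f k‖ :=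
    fun k => by rw [norm_smul, fourier_norm, mul_one]
  have hs : Summable fun k => fourierCoeff f k • (fourier k : C(Circ, ℂ)) :=
    Summable.of_norm (by simpa only [hn] using h)
  set g := ∑' k, fourierCoeff f k • (fourier k : C(Circ, ℂ)) with hg
  refine ⟨g, g.continuous, ?_, fun x => ?_⟩
  · rw [volume_eq_haar] at *
    have h1 := (ContinuousMap.toLp (E := ℂ) 2 AddCircle.haarAddCircle ℂ).hasSum hs.hasSum
    have h2 := hasSum_fourier_series_L2 hf.toLp
    simp only [fourierCoeff_congr_ae hf.coeFn_toLp] at h2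
    have h3 := h2.unique (by simpa only [map_smul] using h1)
    have h4 := ContinuousMap.coeFn_toLp (p := 2) (𝕜 := ℂ) (μ := AddCircle.haarAddCircle) g
    rw [← h3] at h4
    exact hf.coeFn_toLp.symm.trans h4
  · refine (g.norm_coe_le_norm x).trans ?_
    refine (norm_tsum_le_tsum_norm (by simpa only [hn] using h)).trans ?_
    simp only [hn, le_refl]

end Fourier

/-! ### Morrey embedding and `C¹` representatives -/

section Embedding

variable {s : ℝ} {n : ℕ}

lemma lintegral_enorm_sq_eq {α F : Type*} [MeasurableSpace α] {μ : Measure α}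
    [NormedAddCommGroup F] (f : α → F) : ∫⁻ x, ‖f x‖ₑ ^ 2 ∂μ = eLpNorm f 2 μ ^ 2 := by
  have := eLpNorm_nnreal_pow_eq_lintegral (f := f) (μ := μ) (p := 2) two_ne_zero
  simpa using this.symm

/-- The factor `d⁻¹` of `mu` and the squared weight `d^(-2σ)` combine into the kernel of `slobSq`.
-/
lemma lintegral_mu_enorm_sq {σ : ℝ} (hσ : 0 < σ) {Ψ : Circ × Circ → Amb n} (hΨ : Measurable Ψ) :
    ∫⁻ p, ‖(dist p.2 p.1 ^ σ)⁻¹ • Ψ p‖ₑ ^ 2 ∂mu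
      = ∫⁻ x, ∫⁻ y, ENNReal.ofReal (dist y x ^ (-(1 + 2 * σ))) * ‖Ψ (x, y)‖ₑ ^ 2 := by
  have hk : Measurable fun p : Circ × Circ => ENNReal.ofReal (dist p.2 p.1)⁻¹ :=
    (measurable_snd.dist measurable_fst).inv.ennreal_ofReal
  have hd : Measurable fun p : Circ × Circ => ‖(dist p.2 p.1 ^ σ)⁻¹ • Ψ p‖ₑ ^ 2 := by
    have h1 : Measurable fun p : Circ × Circ => (dist p.2 p.1 ^ σ)⁻¹ :=
      ((measurable_snd.dist measurable_fst).pow_const σ).inv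
    exact (h1.smul hΨ).enorm.pow_const 2
  rw [mu, lintegral_withDensity_eq_lintegral_mul _ hk hd,
    lintegral_prod _ (hk.mul hd).aemeasurable]
  congr 1 with x
  congr 1 with y
  simp only [Pi.mul_apply]
  rw [enorm_smul, mul_pow, ← mul_assoc]
  congr 1
  have h0 : 0 ≤ dist y x := dist_nonneg
  rw [← ofReal_norm, ← ENNReal.ofReal_pow (norm_nonneg _), ← ENNReal.ofReal_mul (by positivity),
    Real.norm_of_nonneg (by positivity)]
  congr 1
  -- On the diagonal both sides are zero by the conventions for inverses and powers of zero.
  rcases h0.eq_or_lt with h | h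
  · rw [← h, Real.zero_rpow (show -(1 + 2 * σ) ≠ 0 by linarith)]; simp
  · rw [Real.rpow_neg h0, Real.rpow_add h, Real.rpow_one, two_mul, Real.rpow_add h, mul_inv,
      mul_inv]
    ring

lemma slobSq_eq_fracDiff {σ : ℝ} (hσ : 0 < σ) {w : Circ → Amb n} (hw : Measurable w) :
    slobSq σ w = ∫⁻ p, ‖fracDiff σ w p‖ₑ ^ 2 ∂mu :=
  (lintegral_mu_enorm_sq hσ ((hw.comp measurable_snd).sub (hw.comp measurable_fst))).symm

lemma abs_coord_le (x : Amb n) (j : Fin n) : |x j| ≤ ‖x‖ := by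
  simpa using PiLp.norm_apply_le (p := 2) x j

lemma norm_le_of_coord_le {x : Amb n} {B : ℝ} (hB : 0 ≤ B) (h : ∀ j, |x j| ≤ B) :
    ‖x‖ ≤ √n * B := by
  rw [EuclideanSpace.norm_eq, ← Real.sqrt_sq hB, ← Real.sqrt_mul (Nat.cast_nonneg n)]
  refine Real.sqrt_le_sqrt ?_
  refine (Finset.sum_le_card_nsmul _ _ (B ^ 2) fun j _ => ?_).trans (by simp)
  rw [Real.norm_eq_abs]
  exact pow_le_pow_left₀ (abs_nonneg _) (h j) 2

/-- The fractional Morrey embedding: functions in the Slobodeckij space of order `σ > 1 / 2`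
are continuous. -/
lemma exists_continuous_rep {σ : ℝ} (hσ : 1 / 2 < σ) (n : ℕ) :
    ∃ C : ℝ, 0 ≤ C ∧ ∀ (w : Circ → Amb n) (N : ℝ), 0 ≤ N → Measurable w →
      ∫⁻ x, ‖w x‖ₑ ^ 2 ≤ ENNReal.ofReal (N ^ 2) → slobSq σ w ≤ ENNReal.ofReal (N ^ 2) →
      ∃ g : Circ → Amb n, Continuous g ∧ w =ᵐ[volume] g ∧ ∀ x, ‖g x‖ ≤ C * N := by
  obtain ⟨C, hC, H⟩ := tsum_enorm_fourierCoeff_sq_le hσ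
  -- The `2` comes from adding the `L²` and seminorm bounds, each at most `N ^ 2`; `√n` comes from
  -- passing from coordinates to the Euclidean norm.
  refine ⟨√n * √(C * 2), by positivity, fun w N hN hw h2 hsl => ?_⟩
  have key : ∀ j : Fin n, ∃ g : Circ → ℂ, Continuous g ∧
      (fun x => ((w x j : ℝ) : ℂ)) =ᵐ[volume] g ∧ ∀ x, ‖g x‖ ≤ √(C * 2) * N := by
    intro j
    set f : Circ → ℂ := fun x => ((w x j : ℝ) : ℂ) with hf
    have hle : ∀ x, ‖f x‖ₑ ≤ ‖w x‖ₑ := fun x => by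
      rw [enorm_le_iff_norm_le]
      simpa [hf] using abs_coord_le (w x) j
    have hfm : Measurable f :=
      Complex.measurable_ofReal.comp
        ((EuclideanSpace.proj (𝕜 := ℝ) j).continuous.measurable.comp hw)
    have hf2 : ∫⁻ x, ‖f x‖ₑ ^ 2 ≤ ENNReal.ofReal (N ^ 2) :=
      (lintegral_mono fun x => pow_le_pow_left' (hle x) 2).trans h2
    have hmem : MemLp f 2 volume := by
      refine ⟨hfm.aestronglyMeasurable, ?_⟩
      rw [lintegral_enorm_sq_eq] at hf2
      have := hf2.trans_lt ENNReal.ofReal_lt_top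
      exact (ENNReal.pow_lt_top_iff.1 this).resolve_right two_ne_zero
    have hfs : slobSq σ f ≤ ENNReal.ofReal (N ^ 2) := by
      refine le_trans (lintegral_mono fun x => lintegral_mono fun y => ?_) hsl
      refine mul_le_mul' le_rfl (pow_le_pow_left' ?_ 2)
      rw [enorm_le_iff_norm_le]
      have : f y - f x = (((w y - w x) j : ℝ) : ℂ) := by simp [hf]
      rw [this, Complex.norm_real]
      exact abs_coord_le _ j
    have h3 := H f hfm hmem
    have h4 : ENNReal.ofReal C * ((∫⁻ x, ‖f x‖ₑ ^ 2) + slobSq σ f)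
        ≤ ENNReal.ofReal (√(C * 2) * N) ^ 2 := by
      calc _ ≤ ENNReal.ofReal C * (ENNReal.ofReal (N ^ 2) + ENNReal.ofReal (N ^ 2)) := by gcongr
        _ = _ := by
          rw [← ENNReal.ofReal_add (by positivity) (by positivity), ← ENNReal.ofReal_mul hC,
            ← ENNReal.ofReal_pow (by positivity), mul_pow, Real.sq_sqrt (by positivity)]
          congr 1
          ring
    have h5 : ∑' k : ℤ, ‖fourierCoeff f k‖ₑ ≤ ENNReal.ofReal (√(C * 2) * N) :=
      (ENNReal.pow_le_pow_left_iff two_ne_zero).1 (h3.trans h4)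
    have hsum : Summable fun k => ‖fourierCoeff f k‖ :=
      tsum_enorm_ne_top_iff_summable_norm.1 (h5.trans_lt ENNReal.ofReal_lt_top).ne
    obtain ⟨g, hg, hfg, hgb⟩ := exists_continuous_of_summable hmem hsum
    refine ⟨g, hg, hfg, fun x => (hgb x).trans ?_⟩
    rw [← ENNReal.ofReal_le_ofReal_iff (by positivity),
      ENNReal.ofReal_tsum_of_nonneg (fun _ => norm_nonneg _) hsum]
    simpa only [ofReal_norm] using h5
  choose g hg hwg hgb using key
  refine ⟨fun x => WithLp.toLp 2 fun j => (g j x).re, ?_, ?_, fun x => ?_⟩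
  · refine (PiLp.continuous_toLp 2 _).comp (continuous_pi fun j => ?_)
    exact Complex.continuous_re.comp (hg j)
  · filter_upwards [ae_all_iff.2 hwg] with x hx
    ext j
    simp [← hx j]
  · rw [mul_assoc]
    exact norm_le_of_coord_le (by positivity) fun j =>
      (Complex.abs_re_le_norm _).trans (hgb j x)

lemma circDeriv_coe_amb {φ : Circ → Amb n} (t : ℝ) :
    circDeriv φ (t : Circ) = deriv (fun r : ℝ => φ (r : Circ)) t := by
  have := deriv_comp_const_add (fun r : ℝ => φ (r : Circ)) t 0
  simp only [add_zero] at this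
  rw [← this]
  simp [circDeriv]

lemma continuous_of_lift {X : Type*} [TopologicalSpace X] {f : Circ → X}
    (h : Continuous fun t : ℝ => f (t : Circ)) : Continuous f :=
  (QuotientAddGroup.isQuotientMap_mk _).continuous_iff.2 h

lemma IsCk.continuous_amb {φ : Circ → Amb n} {k : ℕ∞} (h : IsCk k φ) : Continuous φ :=
  continuous_of_lift (ContDiff.continuous h)

lemma IsCk.hasDerivAt {φ : Circ → Amb n} (h : IsCk 1 φ) (t : ℝ) :
    HasDerivAt (fun r : ℝ => φ (r : Circ)) (circDeriv φ (t : Circ)) t := by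
  rw [circDeriv_coe_amb]
  exact (ContDiff.differentiable h one_ne_zero t).hasDerivAt

lemma IsCk.continuous_circDeriv_amb {φ : Circ → Amb n} (h : IsCk 1 φ) :
    Continuous (circDeriv φ) := by
  refine continuous_of_lift ?_
  simp only [circDeriv_coe_amb]
  exact ContDiff.continuous_deriv h le_rfl

/-- A continuous function of mean zero has a continuously differentiable primitive. -/
lemma exists_primitive {g : Circ → Amb n} (hg : Continuous g) (h0 : ∫ x, g x = 0) :
    ∃ W : Circ → Amb n, IsCk 1 W ∧ ∀ x, circDeriv W x = g x := by
  have hgc : Continuous fun t : ℝ => g (t : Circ) := hg.comp (AddCircle.continuous_mk' 1)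
  let V : ℝ → Amb n := fun t => ∫ τ in (0 : ℝ)..t, g (τ : Circ)
  have hV : ∀ t : ℝ, HasDerivAt V (g (t : Circ)) t := fun t =>
    (hgc.integral_hasStrictDerivAt 0 t).hasDerivAt
  -- Mean zero is what makes the primitive on the line descend to the circle.
  have hper : Function.Periodic V 1 := fun t => by
    have h1 : V (t + 1) = V t + ∫ τ in t..t + 1, g (τ : Circ) :=
      (intervalIntegral.integral_add_adjacent_intervals (hgc.intervalIntegrable _ _)
        (hgc.intervalIntegrable _ _)).symm
    rw [h1, AddCircle.intervalIntegral_preimage 1 t g, h0, add_zero]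
  have hlift : (fun t : ℝ => hper.lift (t : Circ)) = V := by
    ext1 t; exact hper.lift_coe t
  have hder : deriv V = fun t : ℝ => g (t : Circ) := by
    ext1 t; exact (hV t).deriv
  refine ⟨hper.lift, ?_, fun x => ?_⟩
  · unfold IsCk
    rw [hlift]
    refine contDiff_one_iff_deriv.2 ⟨fun t => (hV t).differentiableAt, ?_⟩
    rw [hder]; exact hgc
  · obtain ⟨t, rfl⟩ := QuotientAddGroup.mk_surjective x
    rw [circDeriv_coe_amb, hlift, hder]

/-- Integration by parts over one period; the boundary terms cancel by periodicity. -/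
lemma IsCk.isWeakDeriv {W : Circ → Amb n} (hW : IsCk 1 W) : IsWeakDeriv W (circDeriv W) := by
  intro φ hφ
  have hd : ∀ t : ℝ, HasDerivAt (fun r : ℝ => φ (r : Circ)) (circDeriv φ (t : Circ)) t := by
    intro t
    rw [circDeriv_coe]
    exact (ContDiff.differentiable hφ (by simp) t).hasDerivAt
  have hmk := AddCircle.continuous_mk' (1 : ℝ)
  have := intervalIntegral.integral_smul_deriv_eq_deriv_smul (a := 0) (b := 0 + 1)
    (u := fun t : ℝ => φ (t : Circ)) (v := fun t : ℝ => W (t : Circ))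
    (fun t _ => hd t) (fun t _ => hW.hasDerivAt t)
    ((hφ.continuous_circDeriv.comp hmk).intervalIntegrable _ _)
    ((hW.continuous_circDeriv_amb.comp hmk).intervalIntegrable _ _)
  rw [AddCircle.intervalIntegral_preimage 1 0 (fun x => φ x • circDeriv W x),
    AddCircle.intervalIntegral_preimage 1 0 (fun x => circDeriv φ x • W x)] at this
  have hp : (((0 : ℝ) + 1 : ℝ) : Circ) = ((0 : ℝ) : Circ) := by
    rw [AddCircle.coe_add, AddCircle.coe_period, add_zero]
  rw [this, hp]
  abel

/-- Trigonometric test functions: the real and the imaginary part of a Fourier monomial. -/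
lemma isCk_fourier (k : ℤ) :
    (IsCk ⊤ fun x : Circ => ((fourier k x : ℂ)).re) ∧
    (IsCk ⊤ fun x : Circ => ((fourier k x : ℂ)).im) ∧
    (∀ x : Circ, circDeriv (fun x : Circ => ((fourier k x : ℂ)).re) x
      = -(2 * Real.pi * k) * ((fourier k x : ℂ)).im) ∧
    (∀ x : Circ, circDeriv (fun x : Circ => ((fourier k x : ℂ)).im) x
      = (2 * Real.pi * k) * ((fourier k x : ℂ)).re) := by
  have e : ∀ t : ℝ, (fourier k (t : Circ) : ℂ)
      = Complex.exp (((2 * Real.pi * k * t : ℝ) : ℂ) * Complex.I) := fun t => by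
    rw [fourier_coe_apply]; congr 1; push_cast; ring
  have hre : ∀ t : ℝ, ((fourier k (t : Circ) : ℂ)).re = Real.cos (2 * Real.pi * k * t) :=
    fun t => by rw [e, Complex.exp_ofReal_mul_I_re]
  have him : ∀ t : ℝ, ((fourier k (t : Circ) : ℂ)).im = Real.sin (2 * Real.pi * k * t) :=
    fun t => by rw [e, Complex.exp_ofReal_mul_I_im]
  have hlin : ∀ t : ℝ, HasDerivAt (fun t : ℝ => 2 * Real.pi * k * t) (2 * Real.pi * k) t :=
    fun t => by simpa using (hasDerivAt_id t).const_mul (2 * Real.pi * (k : ℝ))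
  refine ⟨?_, ?_, fun x => ?_, fun x => ?_⟩
  · unfold IsCk
    simp only [hre]
    exact Real.contDiff_cos.comp (contDiff_const.mul contDiff_id)
  · unfold IsCk
    simp only [him]
    exact Real.contDiff_sin.comp (contDiff_const.mul contDiff_id)
  · obtain ⟨t, rfl⟩ := QuotientAddGroup.mk_surjective x
    rw [circDeriv_coe, him]
    simp only [hre]
    rw [((hlin t).cos).deriv]
    ring
  · obtain ⟨t, rfl⟩ := QuotientAddGroup.mk_surjective x
    rw [circDeriv_coe, hre]
    simp only [him]
    rw [((hlin t).sin).deriv]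
    ring

lemma integrable_smul_of_memLp {ψ : Circ → ℝ} (hψ : Continuous ψ) {v : Circ → Amb n}
    (hv : MemLp v 2 volume) : Integrable (fun x => ψ x • v x) := by
  refine (integrable_smul_Lp hψ hv.toLp).congr ?_
  filter_upwards [hv.coeFn_toLp] with x hx
  rw [hx]

/-- A function with vanishing weak derivative is constant. -/
lemma ae_const_of_weakDeriv_zero {v : Circ → Amb n} (hv : MemLp v 2 volume)
    (h : ∀ φ : Circ → ℝ, IsCk ⊤ φ → ∫ x, circDeriv φ x • v x = 0) :
    ∃ c : Amb n, v =ᵐ[volume] fun _ => c := by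
  have hj : ∀ j : Fin n, MemLp (fun x => ((v x j : ℝ) : ℂ)) 2 volume := fun j => by
    have := (Complex.ofRealCLM.comp (EuclideanSpace.proj (𝕜 := ℝ) j)).comp_memLp' hv
    exact this
  -- Testing against the real and imaginary parts of the character of frequency `-k` works because
  -- differentiation swaps them up to the factors `±2πk`, which are nonzero.
  have hcoef : ∀ j : Fin n, ∀ k : ℤ, k ≠ 0 → fourierCoeff (fun x => ((v x j : ℝ) : ℂ)) k = 0 := by
    intro j k hk
    obtain ⟨h1, h2, h3, h4⟩ := isCk_fourier (-k)
    have hc : (2 * Real.pi * ((-k : ℤ) : ℝ)) ≠ 0 := by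
      have : ((-k : ℤ) : ℝ) ≠ 0 := by exact_mod_cast neg_ne_zero.2 hk
      have := Real.pi_ne_zero
      positivity
    have hcoord : ∀ ψ : Circ → ℝ, Continuous ψ → ∀ c : ℝ, c ≠ 0 →
        ∫ x, (c * ψ x) • v x = 0 → ∫ x, ((ψ x : ℝ) : ℂ) * ((v x j : ℝ) : ℂ) = 0 := by
      intro ψ hψ c hc0 hint
      simp only [mul_smul] at hint
      rw [integral_smul, smul_eq_zero_iff_right hc0] at hint
      have := (Complex.ofRealCLM.comp (EuclideanSpace.proj (𝕜 := ℝ) j)).integral_comp_comm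
        (integrable_smul_of_memLp hψ hv)
      rw [hint, map_zero] at this
      simpa using this
    have hcr : Continuous fun x : Circ => ((fourier (-k) x : ℂ)).re := h1.continuous
    have hci : Continuous fun x : Circ => ((fourier (-k) x : ℂ)).im := h2.continuous
    have a1 := h _ h1
    have a2 := h _ h2
    simp only [h3, h4] at a1 a2
    have b1 := hcoord _ hci _ (neg_ne_zero.2 hc) a1
    have b2 := hcoord _ hcr _ hc a2
    have hint : ∀ ψ : Circ → ℝ, Continuous ψ →
        Integrable fun x => ((ψ x : ℝ) : ℂ) * ((v x j : ℝ) : ℂ) := by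
      intro ψ hψ
      have := (Complex.ofRealCLM.comp (EuclideanSpace.proj (𝕜 := ℝ) j)).integrable_comp
        (integrable_smul_of_memLp hψ hv)
      simpa using this
    have hsplit : ∀ x : Circ, fourier (-k) x • ((v x j : ℝ) : ℂ)
        = (((fourier (-k) x : ℂ)).re : ℂ) * ((v x j : ℝ) : ℂ)
          + Complex.I * ((((fourier (-k) x : ℂ)).im : ℂ) * ((v x j : ℝ) : ℂ)) := fun x => by
      conv_lhs => rw [smul_eq_mul, ← Complex.re_add_im (fourier (-k) x)]
      ring
    unfold fourierCoeff
    rw [← volume_eq_haar]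
    simp only [hsplit]
    rw [integral_add (hint _ hcr) ((hint _ hci).const_mul _), integral_const_mul, b1, b2]
    simp
  have hconst : ∀ j : Fin n, ∃ c : ℂ, (fun x => ((v x j : ℝ) : ℂ)) =ᵐ[volume] fun _ => c := by
    intro j
    refine ⟨fourierCoeff (fun x => ((v x j : ℝ) : ℂ)) 0,
      ae_eq_of_fourierCoeff_eq (hj j) (memLp_const _) fun k => ?_⟩
    have e : (fun _ : Circ => fourierCoeff (fun x => ((v x j : ℝ) : ℂ)) 0)
        = fun x => fourierCoeff (fun x => ((v x j : ℝ) : ℂ)) 0 * (fourier 0 : C(Circ, ℂ)) x := by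
      ext x; simp
    rw [e, fourierCoeff.const_mul, fourierCoeff_fourier]
    rcases eq_or_ne k 0 with rfl | hk
    · simp
    · simp [hcoef j k hk, hk]
  choose c hc using hconst
  refine ⟨WithLp.toLp 2 fun j => (c j).re, ?_⟩
  filter_upwards [ae_all_iff.2 hc] with x hx
  ext j
  simp [← hx j]

lemma memLp_of_continuous {g : Circ → Amb n} (hg : Continuous g) : MemLp g 2 volume := by
  obtain ⟨C, hC⟩ := isCompact_univ.exists_bound_of_continuousOn hg.continuousOn
  exact MemLp.of_bound hg.aestronglyMeasurable C (.of_forall fun x => hC x (mem_univ x))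

/-- A function with a continuous weak derivative is continuously differentiable. -/
lemma exists_isCk_of_isWeakDeriv {u w g : Circ → Amb n} (hu : MemLp u 2 volume)
    (hg : Continuous g) (hwg : w =ᵐ[volume] g) (h : IsWeakDeriv u w) :
    ∃ f : Circ → Amb n, IsCk 1 f ∧ u =ᵐ[volume] f ∧ ∀ x, circDeriv f x = g x := by
  have h' : ∀ φ : Circ → ℝ, IsCk ⊤ φ → ∫ x, circDeriv φ x • u x = - ∫ x, φ x • g x := by
    intro φ hφ
    rw [h φ hφ]
    congr 1
    refine integral_congr_ae ?_
    filter_upwards [hwg] with x hx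
    rw [hx]
  -- The constant test function shows that a weak derivative has mean zero, so a periodic primitive
  -- exists.
  have h0 : ∫ x, g x = 0 := by
    have h1 : IsCk ⊤ fun _ : Circ => (1 : ℝ) := contDiff_const
    have := h' _ h1
    simpa [circDeriv] using this.symm
  obtain ⟨W, hW, hWg⟩ := exists_primitive hg h0
  have hWm := memLp_of_continuous hW.continuous_amb
  obtain ⟨c, hc⟩ := ae_const_of_weakDeriv_zero (hu.sub hWm) fun φ hφ => by
    have e1 := h' φ hφ
    have e2 := hW.isWeakDeriv φ hφ
    simp only [hWg] at e2
    simp only [Pi.sub_apply, smul_sub]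
    rw [integral_sub (integrable_smul_of_memLp hφ.continuous_circDeriv hu)
      (integrable_smul_of_memLp hφ.continuous_circDeriv hWm), e1, e2, sub_self]
  refine ⟨fun x => W x + c, ContDiff.add hW contDiff_const, ?_, fun x => ?_⟩
  · filter_upwards [hc] with x hx
    rw [← hx, Pi.sub_apply]
    abel
  · rw [← hWg]
    simp [circDeriv]

end Embedding

/-! ### Hardy inequality and the Taylor remainder -/

section Hardy

lemma lintegral_sq_le {α : Type*} [MeasurableSpace α] {μ : Measure α} {f : α → ℝ≥0∞}
    (hf : AEMeasurable f μ) : (∫⁻ x, f x ∂μ) ^ 2 ≤ μ univ * ∫⁻ x, f x ^ 2 ∂μ := by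
  have h := ENNReal.lintegral_mul_le_Lp_mul_Lq μ Real.HolderConjugate.two_two
    (f := fun _ => 1) (g := f) aemeasurable_const hf
  simp only [Pi.mul_apply, one_mul, ENNReal.rpow_two, one_pow,
    lintegral_one] at h
  refine (pow_le_pow_left' h 2).trans (le_of_eq ?_)
  rw [mul_pow, ← ENNReal.rpow_two, ← ENNReal.rpow_two, ← ENNReal.rpow_mul, ← ENNReal.rpow_mul]
  norm_num

lemma lintegral_Ici_rpow {a : ℝ} (ha : a < -1) {ρ : ℝ} (hρ : 0 < ρ) :
    ∫⁻ t in Ici ρ, ENNReal.ofReal (|t| ^ a) = ENNReal.ofReal (-ρ ^ (a + 1) / (a + 1)) := by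
  rw [← integral_Ioi_rpow_of_lt ha hρ, ofReal_integral_eq_lintegral_ofReal
    (integrableOn_Ioi_rpow_of_lt ha hρ), setLIntegral_congr Ioi_ae_eq_Ici.symm]
  · refine setLIntegral_congr_fun measurableSet_Ioi fun t ht => ?_
    simp only [abs_of_pos (hρ.trans ht)]
  · filter_upwards [ae_restrict_mem measurableSet_Ioi] with t ht
    exact Real.rpow_nonneg (hρ.trans ht).le a

lemma lintegral_abs_rpow_le {a : ℝ} (ha : a < -1) {ρ : ℝ} (hρ : 0 < ρ) :
    ∫⁻ t in {t : ℝ | ρ ≤ |t|}, ENNReal.ofReal (|t| ^ a)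
      ≤ ENNReal.ofReal (2 / (-(a + 1))) * ENNReal.ofReal (ρ ^ (a + 1)) := by
  have hset : {t : ℝ | ρ ≤ |t|} = Ici ρ ∪ Iic (-ρ) := by
    ext t
    simp only [mem_ofPred_eq, le_abs, mem_union, mem_Ici, mem_Iic, le_neg]
  have hneg : ∫⁻ t in Iic (-ρ), ENNReal.ofReal (|t| ^ a)
      = ∫⁻ t in Ici ρ, ENNReal.ofReal (|t| ^ a) := by
    rw [← lintegral_indicator measurableSet_Iic, ← lintegral_indicator measurableSet_Ici,
      ← lintegral_neg_eq_self]
    congr 1 with t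
    simp only [indicator, mem_Iic, mem_Ici, neg_le_neg_iff, abs_neg]
  rw [hset]
  refine (lintegral_union_le _ _ _).trans ?_
  rw [hneg, lintegral_Ici_rpow ha hρ, ← ENNReal.ofReal_add, ← ENNReal.ofReal_mul]
  · refine ENNReal.ofReal_le_ofReal (le_of_eq ?_)
    have : a + 1 ≠ 0 := by linarith
    field_simp
    ring
  · exact div_nonneg two_pos.le (by linarith)
  all_goals
    exact div_nonneg_of_nonpos (neg_nonpos.2 (Real.rpow_nonneg hρ.le _)) (by linarith)

/-- Cauchy–Schwarz; enlarging the range to the symmetric interval `|r| ≤ |t|` treats both signs of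
`t` at once and prepares the use of Tonelli. -/
lemma enorm_intervalIntegral_sq_le {F : Type*} [NormedAddCommGroup F] [NormedSpace ℝ F]
    {φ : ℝ → F} (hφ : Continuous φ) (t : ℝ) :
    ‖∫ r in (0 : ℝ)..t, φ r‖ₑ ^ 2
      ≤ ENNReal.ofReal (2 * |t|) * ∫⁻ r in {r : ℝ | |r| ≤ |t|}, ‖φ r‖ₑ ^ 2 := by
  have hset : {r : ℝ | |r| ≤ |t|} = Icc (-|t|) |t| := by
    ext r; simp [abs_le]
  have hvol : (volume.restrict {r : ℝ | |r| ≤ |t|}) univ = ENNReal.ofReal (2 * |t|) := by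
    rw [Measure.restrict_apply_univ, hset, Real.volume_Icc]
    congr 1; ring
  rw [← hvol]
  refine le_trans (pow_le_pow_left' ?_ 2) (lintegral_sq_le hφ.enorm.measurable.aemeasurable)
  have h1 : ‖∫ r in (0 : ℝ)..t, φ r‖ₑ = ‖∫ r in uIoc 0 t, φ r‖ₑ := by
    rw [← ofReal_norm, ← ofReal_norm, intervalIntegral.norm_intervalIntegral_eq]
  rw [h1]
  refine (enorm_integral_le_lintegral_enorm _).trans (lintegral_mono_set fun r hr => ?_)
  have := uIoc_subset_uIcc hr
  have := abs_sub_left_of_mem_uIcc this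
  simpa using this

/-- A weighted Hardy inequality. -/
lemma hardy {F : Type*} [NormedAddCommGroup F] [NormedSpace ℝ F] {s : ℝ} (hs : 1 / 2 < s)
    {φ : ℝ → F} (hφ : Continuous φ) (b : ℝ) :
    ∫⁻ t in Icc (-b) b, ENNReal.ofReal (|t| ^ (-(1 + 2 * s))) * ‖∫ r in (0 : ℝ)..t, φ r‖ₑ ^ 2
      ≤ ENNReal.ofReal (4 / (2 * s - 1)) *
        ∫⁻ r in Icc (-b) b, ENNReal.ofReal (|r| ^ (-(2 * s - 1))) * ‖φ r‖ₑ ^ 2 := by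
  have hms : MeasurableSet {p : ℝ × ℝ | |p.2| ≤ |p.1|} :=
    measurableSet_le (measurable_snd.abs) (measurable_fst.abs)
  -- The factor `2 |t|` from Cauchy–Schwarz raises the exponent from `-(1 + 2s)` to `-2s`.
  let k : ℝ → ℝ → ℝ≥0∞ := fun t r =>
    ENNReal.ofReal 2 * ({p : ℝ × ℝ | |p.2| ≤ |p.1|}.indicator
      (fun p => ENNReal.ofReal (|p.1| ^ (-(2 * s))) * ‖φ p.2‖ₑ ^ 2) (t, r))
  have hk : Measurable (Function.uncurry k) := by
    refine Measurable.const_mul (Measurable.indicator ?_ hms) _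
    exact ((measurable_fst.abs.pow_const _).ennreal_ofReal).mul
      ((hφ.enorm.measurable.comp measurable_snd).pow_const 2)
  calc _ ≤ ∫⁻ t in Icc (-b) b, ∫⁻ r in Icc (-b) b, k t r := by
        refine setLIntegral_mono_ae' measurableSet_Icc (.of_forall fun t ht => ?_)
        have hsub : {r : ℝ | |r| ≤ |t|} ⊆ Icc (-b) b := fun r hr => by
          have := abs_le.2 ht
          exact abs_le.1 (le_trans hr this)
        have hmr : MeasurableSet {r : ℝ | |r| ≤ |t|} :=
          measurableSet_le measurable_id.abs measurable_const
        have hk2 : ∀ r, k t r = {r : ℝ | |r| ≤ |t|}.indicator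
            (fun r => ENNReal.ofReal 2 * (ENNReal.ofReal (|t| ^ (-(2 * s))) * ‖φ r‖ₑ ^ 2)) r := by
          intro r
          simp only [k, indicator, mem_ofPred_eq]
          split_ifs <;> simp
        simp only [hk2]
        rw [lintegral_indicator hmr, Measure.restrict_restrict hmr, inter_eq_left.2 hsub]
        simp only [← mul_assoc]
        rw [lintegral_const_mul' _ _ (by finiteness)]
        refine (mul_le_mul' le_rfl (enorm_intervalIntegral_sq_le hφ t)).trans ?_
        rw [← mul_assoc]
        refine mul_le_mul' ?_ le_rfl
        rw [← ENNReal.ofReal_mul (by positivity), ← ENNReal.ofReal_mul (by positivity)]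
        refine ENNReal.ofReal_le_ofReal (le_of_eq ?_)
        rcases (abs_nonneg t).eq_or_lt with h | h
        · rw [← h, Real.zero_rpow (by linarith), Real.zero_rpow (by linarith)]; simp
        · rw [show -(2 * s) = -(1 + 2 * s) + 1 by ring, Real.rpow_add h, Real.rpow_one]
          ring
    _ = ∫⁻ r in Icc (-b) b, ∫⁻ t in Icc (-b) b, k t r := lintegral_lintegral_swap hk.aemeasurable
    _ ≤ ∫⁻ r in Icc (-b) b, ENNReal.ofReal (4 / (2 * s - 1)) *
        (ENNReal.ofReal (|r| ^ (-(2 * s - 1))) * ‖φ r‖ₑ ^ 2) := by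
        have h0 : ∀ᵐ r : ℝ, r ≠ 0 := compl_mem_ae_iff.2 (measure_singleton 0)
        refine lintegral_mono_ae (ae_restrict_of_ae ?_)
        filter_upwards [h0] with r hr
        have hr' : 0 < |r| := abs_pos.2 hr
        have hmt : MeasurableSet {t : ℝ | |r| ≤ |t|} :=
          measurableSet_le measurable_const measurable_id.abs
        have hk2 : ∀ t, k t r = (ENNReal.ofReal 2 * ‖φ r‖ₑ ^ 2) * {t : ℝ | |r| ≤ |t|}.indicator
            (fun t => ENNReal.ofReal (|t| ^ (-(2 * s)))) t := by
          intro t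
          simp only [k, indicator, mem_ofPred_eq]
          split_ifs
          · ring
          · simp
        simp only [hk2]
        rw [lintegral_const_mul' _ _ (by finiteness)]
        -- Extending the `t`-integral to the whole line gives `∫_{|t| ≥ |r|} |t|^(-2s) = 2/(2s - 1)
        -- · |r|^(-(2s - 1))`, finite since `2s > 1`; with the factor `2` of the kernel this is the
        -- constant `4/(2s - 1)`.
        refine (mul_le_mul' le_rfl (setLIntegral_le_lintegral _ _)).trans ?_
        rw [lintegral_indicator hmt]
        refine (mul_le_mul' le_rfl (lintegral_abs_rpow_le (by linarith) hr')).trans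
          (le_of_eq ?_)
        have e1 : -(2 * s) + 1 = -(2 * s - 1) := by ring
        have e2 : (4 : ℝ) / (2 * s - 1) = 2 * (2 / (2 * s - 1)) := by ring
        rw [e1, neg_neg, e2, ENNReal.ofReal_mul two_pos.le]
        ring
    _ = _ := lintegral_const_mul' _ _ ENNReal.ofReal_ne_top

/-- The signed representative in `(-1/2, 1/2]` of a point of the circle. -/
noncomputable def sd (z : Circ) : ℝ := AddCircle.equivIoc 1 (-1 / 2) z

lemma coe_sd (z : Circ) : ((sd z : ℝ) : Circ) = z :=
  (AddCircle.equivIoc 1 (-1 / 2)).symm_apply_apply z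

lemma abs_sd (z : Circ) : |sd z| = ‖z‖ := by
  have h : sd z ∈ Ioc (-1 / 2 : ℝ) (-1 / 2 + 1) := (AddCircle.equivIoc 1 (-1 / 2) z).2
  have h2 : |sd z| ≤ 1 / 2 := abs_le.2 ⟨by linarith [h.1], by linarith [h.2]⟩
  rw [← norm_coe_circ h2, coe_sd]

lemma sd_coe {t : ℝ} (ht : t ∈ Ioc (-1 / 2 : ℝ) (-1 / 2 + 1)) : sd (t : Circ) = t :=
  congrArg Subtype.val ((AddCircle.equivIoc 1 (-1 / 2 : ℝ)).apply_symm_apply ⟨t, ht⟩)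

lemma measurable_sd : Measurable sd :=
  measurable_subtype_coe.comp (AddCircle.measurableEquivIoc 1 (-1 / 2)).measurable

variable {n : ℕ}

lemma IsCk.hasDerivAt_add {g : Circ → Amb n} (hg : IsCk 1 g) (x : Circ) (t : ℝ) :
    HasDerivAt (fun r : ℝ => g (x + (r : Circ))) (circDeriv g (x + (t : Circ))) t := by
  obtain ⟨a, rfl⟩ := QuotientAddGroup.mk_surjective x
  have := (hg.hasDerivAt (a + t)).comp_const_add a t
  simpa only [AddCircle.coe_add] using this

lemma IsCk.norm_sub_le {g : Circ → Amb n} (hg : IsCk 1 g) {B : ℝ}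
    (hB : ∀ x, ‖circDeriv g x‖ ≤ B) (x y : Circ) : ‖g y - g x‖ ≤ B * dist y x := by
  have := convex_univ.norm_image_sub_le_of_norm_hasDerivWithin_le
    (fun t _ => (hg.hasDerivAt_add x t).hasDerivWithinAt) (fun t _ => hB _) (mem_univ 0)
    (mem_univ (sd (y - x)))
  simpa [coe_sd, abs_sd, dist_eq_norm] using this

lemma IsCk.sub_sub_eq_integral {g : Circ → Amb n} (hg : IsCk 1 g) (x : Circ) (t : ℝ) :
    g (x + (t : Circ)) - g x - t • circDeriv g x
      = ∫ r in (0 : ℝ)..t, (circDeriv g (x + (r : Circ)) - circDeriv g x) := by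
  have hc : Continuous fun r : ℝ => circDeriv g (x + (r : Circ)) :=
    hg.continuous_circDeriv_amb.comp (continuous_const.add (AddCircle.continuous_mk' 1))
  rw [intervalIntegral.integral_sub (hc.intervalIntegrable _ _) (by simp),
    intervalIntegral.integral_eq_sub_of_hasDerivAt (fun r _ => hg.hasDerivAt_add x r)
      (hc.intervalIntegrable _ _)]
  simp

/-- The first order Taylor remainder of a `C¹` map is controlled by the fractional difference of
its derivative. -/
lemma IsCk.lintegral_taylor_le {s : ℝ} (hs : 1 < s) {g : Circ → Amb n} (hg : IsCk 1 g) :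
    ∫⁻ p, ‖(dist p.2 p.1 ^ s)⁻¹ •
        (g p.2 - g p.1 - sd (p.2 - p.1) • circDeriv g p.1)‖ₑ ^ 2 ∂mu
      ≤ ENNReal.ofReal (4 / (2 * s - 1)) * slobSq (s - 1) (circDeriv g) := by
  have hgm := hg.continuous_amb.measurable
  have hdm := hg.continuous_circDeriv_amb.measurable
  have hm : Measurable fun p : Circ × Circ =>
      g p.2 - g p.1 - sd (p.2 - p.1) • circDeriv g p.1 :=
    ((hgm.comp measurable_snd).sub (hgm.comp measurable_fst)).sub
      ((measurable_sd.comp (measurable_snd.sub measurable_fst)).smul (hdm.comp measurable_fst))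
  rw [lintegral_mu_enorm_sq (by linarith) hm, slobSq,
    ← lintegral_const_mul' _ _ ENNReal.ofReal_ne_top]
  refine lintegral_mono fun x => ?_
  dsimp only
  rw [← lintegral_add_left_eq_self _ x, ← AddCircle.lintegral_preimage 1 (-1 / 2)]
  conv_rhs => rw [← lintegral_add_left_eq_self _ x, ← AddCircle.lintegral_preimage 1 (-1 / 2)]
  have hsub : ∀ t ∈ Ioc (-1 / 2 : ℝ) (-1 / 2 + 1), dist (x + (t : Circ)) x = |t| := by
    intro t ht
    rw [dist_eq_norm, add_sub_cancel_left, norm_coe_circ]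
    exact abs_le.2 ⟨by linarith [ht.1], by linarith [ht.2]⟩
  have hc : Continuous fun r : ℝ => circDeriv g (x + (r : Circ)) - circDeriv g x :=
    (hg.continuous_circDeriv_amb.comp
      (continuous_const.add (AddCircle.continuous_mk' 1))).sub continuous_const
  -- For fixed `x`, with `y = x + t`, the remainder is the integral of `g'(x + r) - g'(x)` over `r`
  -- from `0` to `t`. The exponents match because `1 + 2(s - 1) = 2s - 1`.
  have key := hardy (s := s) (by linarith) hc (1 / 2)
  have hIcc : Icc (-(1 / 2) : ℝ) (1 / 2) =ᵐ[volume] Ioc (-1 / 2 : ℝ) (-1 / 2 + 1) := by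
    have : Ioc (-1 / 2 : ℝ) (-1 / 2 + 1) = Ioc (-(1 / 2) : ℝ) (1 / 2) := by norm_num
    rw [this]; exact Ioc_ae_eq_Icc.symm
  rw [setLIntegral_congr hIcc, setLIntegral_congr hIcc] at key
  refine le_trans (le_of_eq ?_) (key.trans (le_of_eq ?_))
  · refine setLIntegral_congr_fun measurableSet_Ioc fun t ht => ?_
    rw [hsub t ht, add_sub_cancel_left, sd_coe ht, hg.sub_sub_eq_integral]
  · congr 1
    refine setLIntegral_congr_fun measurableSet_Ioc fun t ht => ?_
    rw [hsub t ht]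
    congr 4
    ring

end Hardy

/-! ### Bounded linear operators on `H^s` -/

section Operators

variable {s : ℝ} {n : ℕ}

/-- Linearity is asked only almost everywhere, since the chosen representatives `fn` and `der` are
additive and homogeneous only up to null sets. -/
lemma exists_clm_Lp {E F α : Type*} [NormedAddCommGroup E] [NormedSpace ℝ E]
    [NormedAddCommGroup F] [NormedSpace ℝ F] [MeasurableSpace α] {μ : Measure α} {p : ℝ≥0∞}
    [Fact (1 ≤ p)] (Φ : E → α → F) (hm : ∀ u, AEStronglyMeasurable (Φ u) μ)
    (hadd : ∀ u v, Φ (u + v) =ᵐ[μ] Φ u + Φ v) (hsmul : ∀ (c : ℝ) u, Φ (c • u) =ᵐ[μ] c • Φ u)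
    (C : ℝ) (hC : 0 ≤ C) (hb : ∀ u, eLpNorm (Φ u) p μ ≤ ENNReal.ofReal (C * ‖u‖)) :
    ∃ L : E →L[ℝ] Lp F p μ, ∀ u, L u =ᵐ[μ] Φ u := by
  have hmem : ∀ u, MemLp (Φ u) p μ := fun u => ⟨hm u, (hb u).trans_lt ENNReal.ofReal_lt_top⟩
  let L : E →ₗ[ℝ] Lp F p μ :=
    { toFun := fun u => (hmem u).toLp
      map_add' := fun u v => by
        rw [← MemLp.toLp_add]; exact MemLp.toLp_congr _ _ (hadd u v)
      map_smul' := fun c u => by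
        rw [RingHom.id_apply, ← MemLp.toLp_const_smul]; exact MemLp.toLp_congr _ _ (hsmul c u) }
  refine ⟨L.mkContinuous C fun u => ?_, fun u => (hmem u).coeFn_toLp⟩
  change ‖(hmem u).toLp‖ ≤ _
  rw [Lp.norm_toLp]
  exact ENNReal.toReal_le_of_le_ofReal (by positivity) (hb u)

lemma eLpNorm_top_le {F α : Type*} [NormedAddCommGroup F] [MeasurableSpace α] {μ : Measure α}
    {f : α → F} {C : ℝ} (h : ∀ᵐ x ∂μ, ‖f x‖ ≤ C) : eLpNorm f ∞ μ ≤ ENNReal.ofReal C := by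
  rw [eLpNorm_exponent_top]
  refine essSup_le_of_ae_le _ ?_
  filter_upwards [h] with x hx
  rw [← ofReal_norm]
  exact ENNReal.ofReal_le_ofReal hx

lemma eLpNorm_two_le {F α : Type*} [NormedAddCommGroup F] [MeasurableSpace α] {μ : Measure α}
    {f : α → F} {C : ℝ} (hC : 0 ≤ C) (h : ∫⁻ x, ‖f x‖ₑ ^ 2 ∂μ ≤ ENNReal.ofReal (C ^ 2)) :
    eLpNorm f 2 μ ≤ ENNReal.ofReal C := by
  rw [lintegral_enorm_sq_eq, ENNReal.ofReal_pow hC] at h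
  exact (ENNReal.pow_le_pow_left_iff two_ne_zero).1 h

lemma Sob.isWeakDeriv (u : Sob s n) : IsWeakDeriv u.fn u.der := (Subtype.prop u).1

lemma Sob.measurable_fn (u : Sob s n) : Measurable u.fn := (Lp.stronglyMeasurable _).measurable

lemma Sob.measurable_der (u : Sob s n) : Measurable u.der := (Lp.stronglyMeasurable _).measurable

lemma Sob.fn_add (u v : Sob s n) : (u + v).fn =ᵐ[volume] u.fn + v.fn := Lp.coeFn_add _ _

lemma Sob.der_add (u v : Sob s n) : (u + v).der =ᵐ[volume] u.der + v.der := Lp.coeFn_add _ _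

lemma Sob.fn_smul (c : ℝ) (u : Sob s n) : (c • u).fn =ᵐ[volume] c • u.fn := Lp.coeFn_smul _ _

lemma Sob.der_smul (c : ℝ) (u : Sob s n) : (c • u).der =ᵐ[volume] c • u.der :=
  Lp.coeFn_smul _ _

lemma Sob.fn_sub (u v : Sob s n) : (u - v).fn =ᵐ[volume] u.fn - v.fn := Lp.coeFn_sub _ _

lemma lintegral_enorm_sq_Lp_le {α F : Type*} [MeasurableSpace α] {μ : Measure α}
    [NormedAddCommGroup F] (f : Lp F 2 μ) {N : ℝ} (h : ‖f‖ ≤ N) :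
    ∫⁻ x, ‖f x‖ₑ ^ 2 ∂μ ≤ ENNReal.ofReal (N ^ 2) := by
  rw [lintegral_enorm_sq_eq, ← Lp.enorm_def, ENNReal.ofReal_pow ((norm_nonneg _).trans h)]
  gcongr
  rw [← ofReal_norm]
  exact ENNReal.ofReal_le_ofReal h

lemma Sob.lintegral_fn_le (u : Sob s n) :
    ∫⁻ x, ‖u.fn x‖ₑ ^ 2 ≤ ENNReal.ofReal (‖u‖ ^ 2) :=
  lintegral_enorm_sq_Lp_le _ (WithLp.norm_fst_le (p := 2) _ (Subtype.val u : Triple n))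

lemma Sob.lintegral_der_le (u : Sob s n) :
    ∫⁻ x, ‖u.der x‖ₑ ^ 2 ≤ ENNReal.ofReal (‖u‖ ^ 2) :=
  lintegral_enorm_sq_Lp_le _ ((WithLp.norm_fst_le (p := 2) _ _).trans
    (WithLp.norm_snd_le (p := 2) _ (Subtype.val u : Triple n)))

lemma Sob.slobSq_der_le (hs : 1 < s) (u : Sob s n) :
    slobSq (s - 1) u.der ≤ ENNReal.ofReal (‖u‖ ^ 2) := by
  rw [slobSq_eq_fracDiff (by linarith) u.measurable_der]
  have h := lintegral_enorm_sq_Lp_le _ ((WithLp.norm_snd_le (p := 2) _ _).trans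
    (WithLp.norm_snd_le (p := 2) _ (Subtype.val u : Triple n)))
  refine le_trans (le_of_eq (lintegral_congr_ae ?_)) h
  filter_upwards [(Subtype.prop u).2] with p hp
  rw [hp]
  rfl

/-- `g` is the continuously differentiable representative of `u`. -/
def IsRep (u : Sob s n) (g : Circ → Amb n) : Prop :=
  IsCk 1 g ∧ u.fn =ᵐ[volume] g ∧ u.der =ᵐ[volume] circDeriv g

/-- Morrey's embedding of order `s - 1` applied to `u'`; this is where `s > 3/2` is needed. The
constant is uniform in `u`, so the embedding into `C¹` has a derivative bound usable for operators.
-/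
lemma exists_isRep (hs : 3 / 2 < s) (n : ℕ) : ∃ C : ℝ, 0 ≤ C ∧ ∀ u : Sob s n,
    ∃ g, IsRep u g ∧ ∀ x, ‖circDeriv g x‖ ≤ C * ‖u‖ := by
  obtain ⟨C, hC, H⟩ := exists_continuous_rep (σ := s - 1) (by linarith) n
  refine ⟨C, hC, fun u => ?_⟩
  obtain ⟨w, hw, hdw, hb⟩ := H u.der ‖u‖ (norm_nonneg _) u.measurable_der u.lintegral_der_le
    (u.slobSq_der_le (by linarith))
  obtain ⟨g, hg, hug, hgw⟩ := exists_isCk_of_isWeakDeriv (Lp.memLp (Subtype.val u : Triple n).fst)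
    hw hdw u.isWeakDeriv
  refine ⟨g, ⟨hg, hug, ?_⟩, fun x => by rw [hgw]; exact hb x⟩
  rwa [funext hgw]

lemma eq_of_ae_eq_of_isCk {f g : Circ → Amb n} (hf : IsCk 1 f) (hg : IsCk 1 g)
    (h : f =ᵐ[volume] g) : f = g :=
  (Continuous.ae_eq_iff_eq volume hf.continuous_amb hg.continuous_amb).1 h

lemma exists_der_fst (hs : 3 / 2 < s) (n : ℕ) :
    ∃ D : Sob s n →L[ℝ] Lp (Amb n) ∞ mu, ∀ u, D u =ᵐ[mu] fun p => u.der p.1 := by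
  obtain ⟨C, hC, H⟩ := exists_isRep hs n
  refine exists_clm_Lp (E := Sob s n) (μ := mu) (fun u p => u.der p.1)
    (fun u => (u.measurable_der.comp measurable_fst).aestronglyMeasurable)
    (fun u v => ?_) (fun c u => ?_) C hC
    fun u => eLpNorm_top_le ?_
  · filter_upwards [ae_fst_mu (u.der_add v)] with p hp
    exact hp
  · filter_upwards [ae_fst_mu (u.der_smul c)] with p hp
    exact hp
  obtain ⟨g, hg, hb⟩ := H u
  filter_upwards [ae_fst_mu hg.2.2] with p hp
  rw [hp]; exact hb _

lemma exists_der_snd (hs : 3 / 2 < s) (n : ℕ) :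
    ∃ D : Sob s n →L[ℝ] Lp (Amb n) ∞ mu, ∀ u, D u =ᵐ[mu] fun p => u.der p.2 := by
  obtain ⟨C, hC, H⟩ := exists_isRep hs n
  refine exists_clm_Lp (E := Sob s n) (μ := mu) (fun u p => u.der p.2)
    (fun u => (u.measurable_der.comp measurable_snd).aestronglyMeasurable)
    (fun u v => ?_) (fun c u => ?_) C hC
    fun u => eLpNorm_top_le ?_
  · filter_upwards [ae_snd_mu (u.der_add v)] with p hp
    exact hp
  · filter_upwards [ae_snd_mu (u.der_smul c)] with p hp
    exact hp
  obtain ⟨g, hg, hb⟩ := H u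
  filter_upwards [ae_snd_mu hg.2.2] with p hp
  rw [hp]; exact hb _

lemma exists_der (hs : 3 / 2 < s) (n : ℕ) :
    ∃ D : Sob s n →L[ℝ] Lp (Amb n) ∞ (volume : Measure Circ), ∀ u, D u =ᵐ[volume] u.der := by
  obtain ⟨C, hC, H⟩ := exists_isRep hs n
  refine exists_clm_Lp Sob.der (fun u => u.measurable_der.aestronglyMeasurable)
    (fun u v => u.der_add v) (fun c u => u.der_smul c) C hC fun u => eLpNorm_top_le ?_
  obtain ⟨g, hg, hb⟩ := H u
  filter_upwards [hg.2.2] with p hp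
  rw [hp]; exact hb _

lemma exists_fn (s : ℝ) (n : ℕ) :
    ∃ D : Sob s n →L[ℝ] Lp (Amb n) 2 (volume : Measure Circ), ∀ u, D u =ᵐ[volume] u.fn := by
  refine exists_clm_Lp Sob.fn (fun u => u.measurable_fn.aestronglyMeasurable)
    (fun u v => u.fn_add v) (fun c u => u.fn_smul c) 1 zero_le_one fun u => ?_
  rw [one_mul]
  exact eLpNorm_two_le (norm_nonneg _) u.lintegral_fn_le

/-- For the `H¹` term an `L²` bound on `u'` is enough, because its weight is bounded. -/
lemma exists_der_two (s : ℝ) (n : ℕ) :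
    ∃ D : Sob s n →L[ℝ] Lp (Amb n) 2 (volume : Measure Circ), ∀ u, D u =ᵐ[volume] u.der := by
  refine exists_clm_Lp Sob.der (fun u => u.measurable_der.aestronglyMeasurable)
    (fun u v => u.der_add v) (fun c u => u.der_smul c) 1 zero_le_one fun u => ?_
  rw [one_mul]
  exact eLpNorm_two_le (norm_nonneg _) u.lintegral_der_le

lemma measurable_dist_rpow_inv (σ : ℝ) :
    Measurable fun p : Circ × Circ => (dist p.2 p.1 ^ σ)⁻¹ :=
  ((measurable_snd.dist measurable_fst).pow_const σ).inv

/-- The difference quotient is bounded by the Lipschitz constant, hence by the supremum of `|u'|`.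
-/
lemma exists_fracDiff (hs : 3 / 2 < s) (n : ℕ) :
    ∃ Q : Sob s n →L[ℝ] Lp (Amb n) ∞ mu, ∀ u, Q u =ᵐ[mu] fracDiff 1 u.fn := by
  obtain ⟨C, hC, H⟩ := exists_isRep hs n
  refine exists_clm_Lp (E := Sob s n) (μ := mu) (fun u => fracDiff 1 u.fn)
    (fun u => ?_) (fun u v => ?_) (fun c u => ?_) C hC
    fun u => eLpNorm_top_le ?_
  · exact ((measurable_dist_rpow_inv 1).smul ((u.measurable_fn.comp measurable_snd).sub
      (u.measurable_fn.comp measurable_fst))).aestronglyMeasurable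
  · filter_upwards [ae_fst_mu (u.fn_add v), ae_snd_mu (u.fn_add v)] with p h1 h2
    simp only [fracDiff, h1, h2, Pi.add_apply, ← smul_add]
    congr 1; abel
  · filter_upwards [ae_fst_mu (u.fn_smul c), ae_snd_mu (u.fn_smul c)] with p h1 h2
    simp only [fracDiff, h1, h2, Pi.smul_apply, ← smul_sub]
    rw [smul_comm]
  · obtain ⟨g, hg, hb⟩ := H u
    filter_upwards [ae_fst_mu hg.2.1, ae_snd_mu hg.2.1] with p h1 h2
    rw [fracDiff, h1, h2, norm_smul, Real.rpow_one, norm_inv, Real.norm_of_nonneg dist_nonneg]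
    refine inv_mul_le_of_le_mul₀ dist_nonneg (by positivity) ?_
    rw [mul_comm]
    exact hg.1.norm_sub_le hb _ _

/-- The weighted first order Taylor remainder of `u`. -/
noncomputable def taylor (u : Sob s n) (p : Circ × Circ) : Amb n :=
  (dist p.2 p.1 ^ s)⁻¹ • (u.fn p.2 - u.fn p.1 - sd (p.2 - p.1) • u.der p.1)

/-- The Hardy estimate for the `C¹` representative trades the remainder for the seminorm of `u'` of
order `s - 1`, which is part of the norm of `u`. -/
lemma exists_taylor (hs : 3 / 2 < s) (n : ℕ) :
    ∃ T : Sob s n →L[ℝ] Lp (Amb n) 2 mu, ∀ u, T u =ᵐ[mu] taylor u := by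
  obtain ⟨C, hC, H⟩ := exists_isRep hs n
  have h2s : 0 < 2 * s - 1 := by linarith
  refine exists_clm_Lp taylor (fun u => ?_) (fun u v => ?_) (fun c u => ?_) √(4 / (2 * s - 1))
    (Real.sqrt_nonneg _) fun u => eLpNorm_two_le (by positivity) ?_
  · exact ((measurable_dist_rpow_inv s).smul (((u.measurable_fn.comp measurable_snd).sub
      (u.measurable_fn.comp measurable_fst)).sub ((measurable_sd.comp
        (measurable_snd.sub measurable_fst)).smul
          (u.measurable_der.comp measurable_fst)))).aestronglyMeasurable
  · filter_upwards [ae_fst_mu (u.fn_add v), ae_snd_mu (u.fn_add v), ae_fst_mu (u.der_add v)]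
      with p h1 h2 h3
    simp only [taylor, h1, h2, h3, Pi.add_apply, ← smul_add]
    congr 1
    rw [smul_add]
    abel
  · filter_upwards [ae_fst_mu (u.fn_smul c), ae_snd_mu (u.fn_smul c), ae_fst_mu (u.der_smul c)]
      with p h1 h2 h3
    simp only [taylor, h1, h2, h3, Pi.smul_apply]
    rw [smul_comm c, smul_sub c, smul_sub c, smul_comm c]
  · obtain ⟨g, hg, -⟩ := H u
    rw [mul_pow, Real.sq_sqrt (by positivity), ENNReal.ofReal_mul (by positivity)]
    have e : ∫⁻ p, ‖taylor u p‖ₑ ^ 2 ∂mu = ∫⁻ p, ‖(dist p.2 p.1 ^ s)⁻¹ •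
        (g p.2 - g p.1 - sd (p.2 - p.1) • circDeriv g p.1)‖ₑ ^ 2 ∂mu := by
      refine lintegral_congr_ae ?_
      filter_upwards [ae_fst_mu hg.2.1, ae_snd_mu hg.2.1, ae_fst_mu hg.2.2] with p h1 h2 h3
      rw [taylor, h1, h2, h3]
    rw [e]
    refine (hg.1.lintegral_taylor_le (by linarith)).trans ?_
    gcongr
    refine le_trans (le_of_eq ?_) (u.slobSq_der_le (by linarith))
    rw [slobSq_eq_fracDiff (by linarith) u.measurable_der,
      slobSq_eq_fracDiff (by linarith) hg.1.continuous_circDeriv_amb.measurable]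
    refine lintegral_congr_ae ?_
    filter_upwards [ae_fst_mu hg.2.2, ae_snd_mu hg.2.2] with p h1 h2
    simp only [fracDiff, h1, h2]

end Operators

/-! ### Bi-Lipschitz bounds and openness of the set of embeddings -/

section Embeddings

variable {s : ℝ} {n : ℕ}

lemma dist_circ_le (x y : Circ) : dist y x ≤ 1 / 2 := by
  rw [dist_eq_norm]
  refine (AddCircle.norm_le_half_period 1 one_ne_zero).trans ?_
  norm_num

lemma exists_lower_bound_of_le_dist {g : Circ → Amb n} (hgc : Continuous g)
    (hi : Function.Injective g) {δ : ℝ} (hδ : 0 < δ) :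
    ∃ c > 0, ∀ x y, δ ≤ dist y x → c ≤ ‖g y - g x‖ := by
  have hK : IsCompact {p : Circ × Circ | δ ≤ dist p.2 p.1} :=
    (isClosed_le continuous_const (continuous_snd.dist continuous_fst)).isCompact
  have hcont : Continuous fun p : Circ × Circ => ‖g p.2 - g p.1‖ := by fun_prop
  have hpos : ∀ p ∈ {p : Circ × Circ | δ ≤ dist p.2 p.1}, 0 < ‖g p.2 - g p.1‖ := by
    intro p hp
    rw [mem_ofPred_eq] at hp
    refine norm_pos_iff.2 (sub_ne_zero.2 fun h => ?_)
    rw [hi h, dist_self] at hp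
    linarith
  obtain ⟨c, hc, h⟩ := hK.exists_forall_le' hcont.continuousOn hpos
  exact ⟨c, hc, fun x y hxy => h (x, y) hxy⟩

lemma IsCk.norm_taylor_le {g : Circ → Amb n} (hg : IsCk 1 g) {ε δ : ℝ}
    (h : ∀ x y, dist y x ≤ δ → dist (circDeriv g y) (circDeriv g x) ≤ ε) {x y : Circ}
    (hxy : dist y x ≤ δ) :
    ‖g y - g x - sd (y - x) • circDeriv g x‖ ≤ ε * dist y x := by
  have hsd : |sd (y - x)| = dist y x := by rw [abs_sd, dist_eq_norm]
  have h0 := hg.sub_sub_eq_integral x (sd (y - x))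
  rw [coe_sd, add_sub_cancel] at h0
  rw [h0]
  refine (intervalIntegral.norm_integral_le_of_norm_le_const (C := ε) fun r hr => ?_).trans
    (by rw [sub_zero, hsd])
  rw [← dist_eq_norm]
  have hr' := abs_sub_left_of_mem_uIcc (uIoc_subset_uIcc hr)
  rw [sub_zero, sub_zero, hsd] at hr'
  refine h _ _ ?_
  rw [dist_eq_norm, add_sub_cancel_left, norm_coe_circ (hr'.trans (dist_circ_le x y))]
  exact hr'.trans hxy

/-- A continuously differentiable embedding of the circle is bi-Lipschitz. -/
lemma IsCk.exists_lower_bound {g : Circ → Amb n} (hg : IsCk 1 g) (hi : Function.Injective g)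
    (hd : ∀ x, circDeriv g x ≠ 0) :
    ∃ c > 0, (∀ x y, c * dist y x ≤ ‖g y - g x‖) ∧ ∀ x, c ≤ ‖circDeriv g x‖ := by
  have hdc := hg.continuous_circDeriv_amb
  obtain ⟨c₁, hc₁, h₁⟩ := isCompact_univ.exists_forall_le' hdc.norm.continuousOn
    fun x _ => norm_pos_iff.2 (hd x)
  have huc := CompactSpace.uniformContinuous_of_continuous hdc
  rw [Metric.uniformContinuous_iff_le] at huc
  -- Within distance `δ` the linear part, at least `c₁ d`, dominates a remainder of at most `(c₁ /
  -- 2) d`; beyond `δ` compactness and injectivity give a positive lower bound `c₂`, and `d ≤ 1`.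
  obtain ⟨δ, hδ, hδ'⟩ := huc (c₁ / 2) (half_pos hc₁)
  obtain ⟨c₂, hc₂, h₂⟩ := exists_lower_bound_of_le_dist hg.continuous_amb hi hδ
  refine ⟨min (c₁ / 2) c₂, lt_min (half_pos hc₁) hc₂, fun x y => ?_, fun x => ?_⟩
  · rcases le_total δ (dist y x) with h | h
    · calc _ ≤ c₂ * 1 := by
            gcongr
            · exact min_le_right _ _
            · linarith [dist_circ_le x y]
        _ ≤ _ := by rw [mul_one]; exact h₂ x y h
    · have hsd : |sd (y - x)| = dist y x := by rw [abs_sd, dist_eq_norm]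
      have key := hg.norm_taylor_le (fun x y h => hδ' h) h
      have h3 := norm_sub_norm_le (sd (y - x) • circDeriv g x)
        (sd (y - x) • circDeriv g x - (g y - g x))
      rw [sub_sub_cancel, norm_smul, Real.norm_eq_abs, hsd,
        norm_sub_rev (sd (y - x) • circDeriv g x)] at h3
      have h4 : dist y x * c₁ ≤ dist y x * ‖circDeriv g x‖ :=
        mul_le_mul_of_nonneg_left (h₁ x (mem_univ x)) dist_nonneg
      have h5 : min (c₁ / 2) c₂ * dist y x ≤ c₁ / 2 * dist y x :=
        mul_le_mul_of_nonneg_right (min_le_left _ _) dist_nonneg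
      linarith
  · have := h₁ x (mem_univ x)
    linarith [min_le_left (c₁ / 2) c₂]

/-- Two `C¹` maps that agree almost everywhere coincide, so the embedding in the definition is the
Morrey representative and its derivative represents `γ.der`. -/
lemma exists_isRep_of_mem_embeddings (hs : 3 / 2 < s) {γ : Sob s n} (hγ : γ ∈ embeddings s n) :
    ∃ g, IsRep γ g ∧ ∃ c > 0, (∀ x y, c * dist y x ≤ ‖g y - g x‖) ∧
      ∀ x, c ≤ ‖circDeriv g x‖ := by
  obtain ⟨g, hγg, hg, hi, hd⟩ := hγ
  obtain ⟨C, -, H⟩ := exists_isRep hs n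
  obtain ⟨f, hf, -⟩ := H γ
  have : f = g := eq_of_ae_eq_of_isCk hf.1 hg (hf.2.1.symm.trans hγg)
  subst this
  exact ⟨f, hf, hg.exists_lower_bound hi hd⟩

lemma circDeriv_add {f g : Circ → Amb n} (hf : IsCk 1 f) (hg : IsCk 1 g) (x : Circ) :
    circDeriv (fun y => f y + g y) x = circDeriv f x + circDeriv g x := by
  have h1 := hf.hasDerivAt_add x 0
  have h2 := hg.hasDerivAt_add x 0
  rw [AddCircle.coe_zero, add_zero] at h1 h2
  exact (h1.fun_add h2).deriv

/-- A perturbation whose derivative is everywhere smaller than the lower bound `c` of the embedding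
destroys neither injectivity nor immersion. -/
lemma isOpen_embeddings (hs : 3 / 2 < s) (n : ℕ) : IsOpen (embeddings s n) := by
  rw [Metric.isOpen_iff]
  intro γ hγ
  obtain ⟨g, hg, c, hc, h1, h2⟩ := exists_isRep_of_mem_embeddings hs hγ
  obtain ⟨C, hC, H⟩ := exists_isRep hs n
  -- `C + 1` instead of `C` because the Morrey constant may be zero.
  refine ⟨c / (C + 1), by positivity, fun v hv => ?_⟩
  rw [Metric.mem_ball, dist_eq_norm, lt_div_iff₀ (by positivity)] at hv
  obtain ⟨k, hk, hkb⟩ := H (v - γ)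
  have hlt : C * ‖v - γ‖ < c := by nlinarith [norm_nonneg (v - γ)]
  refine ⟨fun x => g x + k x, ?_, ContDiff.add hg.1 hk.1, fun x y hxy => ?_, fun x hx => ?_⟩
  · filter_upwards [hg.2.1, hk.2.1, v.fn_sub γ] with x e1 e2 e3
    rw [← e1, ← e2, e3, Pi.sub_apply]
    abel
  · by_contra hne
    have hd : 0 < dist x y := dist_pos.2 hne
    have e1 : g x - g y = -(k x - k y) := by
      have : g x + k x = g y + k y := hxy
      rw [neg_sub, sub_eq_sub_iff_add_eq_add, this, add_comm]
    have e2 := h1 y x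
    rw [e1, norm_neg] at e2
    have e3 := hk.1.norm_sub_le hkb y x
    nlinarith
  · rw [circDeriv_add hg.1 hk.1] at hx
    have e1 := h2 x
    rw [eq_neg_of_add_eq_zero_left hx, norm_neg] at e1
    linarith [hkb x]

/-- The density of `mu` vanishes on the diagonal because `0⁻¹ = 0`. -/
lemma ae_mu_dist_pos : ∀ᵐ p ∂mu, 0 < dist p.2 p.1 := by
  have hk : Measurable fun p : Circ × Circ => ENNReal.ofReal (dist p.2 p.1)⁻¹ :=
    (measurable_snd.dist measurable_fst).inv.ennreal_ofReal
  rw [mu, ae_withDensity_iff hk]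
  refine .of_forall fun p hp => dist_nonneg.lt_of_ne fun h => hp ?_
  rw [← h, inv_zero, ENNReal.ofReal_zero]

/-- Squares are bounded because powers of lengths are later formed from the squared length, which is
quadratic in the field. -/
lemma exists_ae_lower_bound (hs : 3 / 2 < s) {γ : Sob s n} (hγ : γ ∈ embeddings s n) :
    ∃ c > 0, (∀ᵐ p ∂mu, c ≤ ‖fracDiff 1 γ.fn p‖ ^ 2) ∧ ∀ᵐ x, c ≤ ‖γ.der x‖ ^ 2 := by
  obtain ⟨g, hg, c, hc, h1, h2⟩ := exists_isRep_of_mem_embeddings hs hγ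
  refine ⟨c ^ 2, by positivity, ?_, ?_⟩
  · filter_upwards [ae_fst_mu hg.2.1, ae_snd_mu hg.2.1, ae_mu_dist_pos] with p e1 e2 hd
    rw [fracDiff, e1, e2, norm_smul, Real.rpow_one, norm_inv, Real.norm_of_nonneg hd.le]
    gcongr
    rw [le_inv_mul_iff₀ hd, mul_comm]
    exact h1 _ _
  · filter_upwards [hg.2.2] with x hx
    rw [hx]
    gcongr
    exact h2 x

end Embeddings

/-! ### Hölder products and weighted `L¹`-valued forms -/

section Forms

variable {s : ℝ} {n : ℕ}

/-- The Euclidean inner product as a bounded bilinear map. -/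
noncomputable def ip (n : ℕ) : Amb n →L[ℝ] Amb n →L[ℝ] ℝ := innerSL ℝ

lemma ip_apply (x y : Amb n) : ip n x y = ⟪x, y⟫ := rfl

lemma contDiffOn_holderL {X α E F G : Type*} [NormedAddCommGroup X] [NormedSpace ℝ X]
    [MeasurableSpace α] {μ : Measure α} {p q r : ℝ≥0∞} [ENNReal.HolderTriple p q r]
    [Fact (1 ≤ p)] [Fact (1 ≤ q)] [Fact (1 ≤ r)]
    [NormedAddCommGroup E] [NormedSpace ℝ E] [NormedAddCommGroup F] [NormedSpace ℝ F]
    [NormedAddCommGroup G] [NormedSpace ℝ G] (B : E →L[ℝ] F →L[ℝ] G) {M : Set X}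
    {f : X → Lp E p μ} {g : X → Lp F q μ} (hf : ContDiffOn ℝ ∞ f M) (hg : ContDiffOn ℝ ∞ g M) :
    ContDiffOn ℝ ∞ (fun γ => B.holderL μ p q r (f γ) (g γ)) M :=
  ((B.holderL μ p q r).contDiff.comp_contDiffOn hf).clm_apply hg

lemma coeFn_holderL {α E F G : Type*} [MeasurableSpace α] {μ : Measure α} {p q r : ℝ≥0∞}
    [ENNReal.HolderTriple p q r] [Fact (1 ≤ p)] [Fact (1 ≤ q)] [Fact (1 ≤ r)]
    [NormedAddCommGroup E] [NormedSpace ℝ E] [NormedAddCommGroup F] [NormedSpace ℝ F]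
    [NormedAddCommGroup G] [NormedSpace ℝ G] (B : E →L[ℝ] F →L[ℝ] G)
    (f : Lp E p μ) (g : Lp F q μ) : B.holderL μ p q r f g =ᵐ[μ] fun x => B (f x) (g x) :=
  ContinuousLinearMap.coeFn_holder (r := r) B f g

/-- Powers of the length of a bounded vector field depend smoothly on the field, as long as the
length is bounded below. -/
lemma exists_norm_rpow {X α : Type*} [NormedAddCommGroup X] [NormedSpace ℝ X]
    [MeasurableSpace α] {μ : Measure α} (D : X →L[ℝ] Lp (Amb n) ∞ μ) {M : Set X}
    (hM : ∀ γ ∈ M, ∃ c > 0, ∀ᵐ x ∂μ, c ≤ ‖D γ x‖ ^ 2) (a : ℝ) :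
    ∃ W : X → Lp ℝ ∞ μ, ContDiffOn ℝ ∞ W M ∧ ∀ γ ∈ M, W γ =ᵐ[μ] fun x => ‖D γ x‖ ^ a := by
  let N : X → Lp ℝ ∞ μ := fun γ => (ip n).holderL μ ∞ ∞ ∞ (D γ) (D γ)
  have hN : ∀ γ, N γ =ᵐ[μ] fun x => ‖D γ x‖ ^ 2 := fun γ => by
    filter_upwards [coeFn_holderL (r := ∞) (ip n) (D γ) (D γ)] with x hx
    rw [hx, ip_apply, real_inner_self_eq_norm_sq]
  have hpos : ∀ γ ∈ M, N γ ∈ posSet μ := fun γ hγ => by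
    obtain ⟨c, hc, h⟩ := hM γ hγ
    refine ⟨c, hc, ?_⟩
    filter_upwards [h, hN γ] with x h1 h2
    rwa [h2]
  -- The exponent is halved because the power is taken of the squared length.
  refine ⟨fun γ => powLp (a / 2) (N γ), (contDiffOn_powLp (a / 2)).comp
    (contDiffOn_holderL (ip n) D.contDiff.contDiffOn D.contDiff.contDiffOn) hpos, fun γ hγ => ?_⟩
  filter_upwards [coeFn_powLp (hpos γ hγ) (a / 2), hN γ] with x h1 h2
  rw [h1, h2, ← Real.rpow_natCast, ← Real.rpow_mul (norm_nonneg _)]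
  congr 1
  push_cast
  ring

variable {E α : Type*} [NormedAddCommGroup E] [NormedSpace ℝ E] [MeasurableSpace α]
  {μ : Measure α} {p q r : ℝ≥0∞} [Fact (1 ≤ p)] [Fact (1 ≤ q)] [Fact (1 ≤ r)]

/-- The bilinear form `(u, v) ↦ m ⟨S u, S v⟩` with values in `L¹`. -/
noncomputable def weightedForm [ENNReal.HolderTriple q q r] [ENNReal.HolderTriple p r 1]
    (m : Lp ℝ p μ) (S : E →L[ℝ] Lp (Amb n) q μ) : E →L[ℝ] E →L[ℝ] Lp ℝ 1 μ :=
  (ContinuousLinearMap.compL ℝ E (Lp ℝ r μ) (Lp ℝ 1 μ)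
    ((ContinuousLinearMap.mul ℝ ℝ).holderL μ p r 1 m)).comp
      (bilinComp ((ip n).holderL μ q q r) S S)

/-- Two choices of exponents occur: a weight in `L^∞` with `S` in `L²` (`r = 1`), and a weight in
`L¹` with `S` in `L^∞` (`r = ∞`). -/
lemma coeFn_weightedForm [ENNReal.HolderTriple q q r] [ENNReal.HolderTriple p r 1]
    (m : Lp ℝ p μ) (S : E →L[ℝ] Lp (Amb n) q μ) (u v : E) :
    weightedForm (r := r) m S u v =ᵐ[μ] fun x => m x * ⟪S u x, S v x⟫ := by
  have h1 := coeFn_holderL (r := r) (ip n) (S u) (S v)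
  have h2 := coeFn_holderL (r := 1) (ContinuousLinearMap.mul ℝ ℝ) m
    ((ip n).holderL μ q q r (S u) (S v))
  filter_upwards [h1, h2] with x e1 e2
  refine e2.trans ?_
  rw [e1]
  rfl

lemma contDiffOn_weightedForm {X : Type*} [NormedAddCommGroup X] [NormedSpace ℝ X]
    [ENNReal.HolderTriple q q r] [ENNReal.HolderTriple p r 1] {M : Set X} {m : X → Lp ℝ p μ}
    {S : X → E →L[ℝ] Lp (Amb n) q μ} (hm : ContDiffOn ℝ ∞ m M) (hS : ContDiffOn ℝ ∞ S M) :
    ContDiffOn ℝ ∞ (fun γ => weightedForm (r := r) (m γ) (S γ)) M := by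
  unfold weightedForm
  exact ((ContinuousLinearMap.contDiff _).comp_contDiffOn
    ((ContinuousLinearMap.contDiff _).comp_contDiffOn hm)).clm_comp
      (contDiffOn_bilinComp _ hS hS)

lemma exists_integral_clm (μ : Measure α) :
    ∃ I : Lp ℝ 1 μ →L[ℝ] ℝ, ∀ f, I f = ∫ x, f x ∂μ :=
  ⟨L1.integralCLM, fun f => by rw [← L1.integral_eq, L1.integral_eq_integral]⟩

end Forms

/-! ### `R_γ` through Taylor remainders -/

section Densities

variable {s : ℝ} {n : ℕ}

lemma fullDeriv_apply (γ u : Sob s n) (x : Circ) (z : Amb n) :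
    fullDeriv γ u x z = (‖γ.der x‖⁻¹ ^ 2 * ⟪γ.der x, z⟫) • u.der x := by
  simp only [fullDeriv, ContinuousLinearMap.smulRight_apply, innerSL_apply_apply,
    real_inner_smul_left, smul_smul]
  congr 1
  ring

lemma norm_fracDiff_one (γ : Sob s n) (p : Circ × Circ) :
    ‖fracDiff 1 γ.fn p‖ = (dist p.2 p.1)⁻¹ * ‖γ.fn p.2 - γ.fn p.1‖ := by
  rw [fracDiff, norm_smul, Real.rpow_one, norm_inv, Real.norm_of_nonneg dist_nonneg]

/-- The operator `opR` in terms of first order Taylor remainders. -/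
lemma opR_eq (γ u : Sob s n) (p : Circ × Circ) (hd : 0 < dist p.2 p.1) (hγ : γ.der p.1 ≠ 0) :
    opR γ u p = ‖fracDiff 1 γ.fn p‖ ^ (-s) •
      (taylor u p - (‖γ.der p.1‖ ^ (-2 : ℝ) * ⟪γ.der p.1, taylor γ p⟫) • u.der p.1) := by
  have hn : 0 < ‖γ.der p.1‖ := norm_pos_iff.2 hγ
  have hds : 0 < dist p.2 p.1 ^ s := Real.rpow_pos_of_pos hd s
  have e1 : ‖fracDiff 1 γ.fn p‖ ^ (-s)
      = (‖γ.fn p.2 - γ.fn p.1‖ ^ s)⁻¹ * dist p.2 p.1 ^ s := by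
    rw [norm_fracDiff_one, Real.rpow_neg (by positivity), Real.mul_rpow (by positivity)
      (norm_nonneg _), Real.inv_rpow hd.le, mul_inv, inv_inv, mul_comm]
  have e2 : ‖γ.der p.1‖ ^ (-2 : ℝ) = ‖γ.der p.1‖⁻¹ ^ 2 := by
    rw [Real.rpow_neg hn.le, Real.rpow_two, inv_pow]
  have e3 : dist p.2 p.1 ^ s * (dist p.2 p.1 ^ s)⁻¹ = 1 := mul_inv_cancel₀ hds.ne'
  have e4 : ‖γ.der p.1‖⁻¹ ^ 2 * ‖γ.der p.1‖ ^ 2 = 1 := by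
    rw [← mul_pow, inv_mul_cancel₀ hn.ne', one_pow]
  rw [e1, e2, opR, fullDeriv_apply, mul_smul _ (dist p.2 p.1 ^ s)]
  congr 1
  unfold taylor
  rw [real_inner_smul_right, inner_sub_right _ (γ.fn p.2 - γ.fn p.1), real_inner_smul_right,
    real_inner_self_eq_norm_sq, smul_sub, smul_smul, smul_smul, e3, one_smul,
    sub_sub (u.fn p.2 - u.fn p.1) (sd (p.2 - p.1) • u.der p.1), ← add_smul]
  congr 2
  -- `e3` cancels the powers of the distance; `e4` expresses that `𝒟_γ u(x)` sends `γ'(x)` to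
  -- `u'(x)`, which removes the linear term.
  linear_combination (-(‖γ.der p.1‖⁻¹ ^ 2 *
    (⟪γ.der p.1, γ.fn p.2 - γ.fn p.1⟫ - sd (p.2 - p.1) * ‖γ.der p.1‖ ^ 2))) * e3
    + sd (p.2 - p.1) * e4

end Densities

/-! ### Smooth dependence of the densities on the curve -/

section Smoothness

variable {s : ℝ} {n : ℕ}

/-- `opR` is a bounded operator into `L²(μ)` that depends smoothly on the curve. -/
lemma exists_opR (hs : 3 / 2 < s) (n : ℕ) :
    ∃ S : Sob s n → Sob s n →L[ℝ] Lp (Amb n) 2 mu, ContDiffOn ℝ ∞ S (embeddings s n) ∧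
      ∀ γ ∈ embeddings s n, ∀ u, S γ u =ᵐ[mu] opR γ u := by
  obtain ⟨D, hD⟩ := exists_der_fst hs n
  obtain ⟨Q, hQ⟩ := exists_fracDiff hs n
  obtain ⟨T, hT⟩ := exists_taylor hs n
  have hDpos : ∀ γ ∈ embeddings s n, ∃ c > 0, ∀ᵐ p ∂mu, c ≤ ‖D γ p‖ ^ 2 := fun γ hγ => by
    obtain ⟨c, hc, -, h⟩ := exists_ae_lower_bound hs hγ
    refine ⟨c, hc, ?_⟩
    filter_upwards [ae_fst_mu h, hD γ] with p h1 h2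
    rwa [h2]
  have hQpos : ∀ γ ∈ embeddings s n, ∃ c > 0, ∀ᵐ p ∂mu, c ≤ ‖Q γ p‖ ^ 2 := fun γ hγ => by
    obtain ⟨c, hc, h, -⟩ := exists_ae_lower_bound hs hγ
    refine ⟨c, hc, ?_⟩
    filter_upwards [h, hQ γ] with p h1 h2
    rwa [h2]
  obtain ⟨W, hW, hW'⟩ := exists_norm_rpow Q hQpos (-s)
  obtain ⟨V, hV, hV'⟩ := exists_norm_rpow D hDpos (-2)
  let sm := ContinuousLinearMap.lsmul ℝ ℝ (E := Amb n)
  let q₁ : Sob s n → Lp ℝ 2 mu := fun γ => (ip n).holderL mu ∞ 2 2 (D γ) (T γ)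
  let q : Sob s n → Lp ℝ 2 mu := fun γ =>
    (ContinuousLinearMap.mul ℝ ℝ).holderL mu ∞ 2 2 (V γ) (q₁ γ)
  have hq : ContDiffOn ℝ ∞ q (embeddings s n) :=
    contDiffOn_holderL _ hV (contDiffOn_holderL _ D.contDiff.contDiffOn T.contDiff.contDiffOn)
  -- The curve enters only through the bounded weight `W γ` and the `L²` coefficient `q γ =
  -- |γ'|^{-2} ⟨γ', Tγ⟩`; `T` and `D` are fixed, so smoothness holds in operator norm.
  refine ⟨fun γ => (sm.holderL mu ∞ 2 2 (W γ)).comp (T - (sm.holderL mu 2 ∞ 2 (q γ)).comp D),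
    ?_, fun γ hγ u => ?_⟩
  · refine ((ContinuousLinearMap.contDiff _).comp_contDiffOn hW).clm_comp
      (contDiffOn_const.sub ?_)
    exact ((ContinuousLinearMap.contDiff _).comp_contDiffOn hq).clm_comp contDiffOn_const
  · obtain ⟨c, hc, hc'⟩ := hDpos γ hγ
    have e1 := coeFn_holderL (r := 2) sm (W γ) (T u - sm.holderL mu 2 ∞ 2 (q γ) (D u))
    have e2 := Lp.coeFn_sub (T u) (sm.holderL mu 2 ∞ 2 (q γ) (D u))
    have e3 := coeFn_holderL (r := 2) sm (q γ) (D u)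
    have e4 := coeFn_holderL (r := 2) (ContinuousLinearMap.mul ℝ ℝ) (V γ) (q₁ γ)
    have e5 := coeFn_holderL (r := 2) (ip n) (D γ) (T γ)
    filter_upwards [e1, e2, e3, e4, e5, hW' γ hγ, hV' γ hγ, hD γ, hD u, hQ γ, hT γ, hT u, hc',
      ae_mu_dist_pos] with p a1 a2 a3 a4 a5 a6 a7 a8 a9 a10 a11 a12 a13 a14
    have hne : γ.der p.1 ≠ 0 := by
      rintro h0
      rw [a8, h0, norm_zero] at a13
      norm_num at a13
      linarith
    refine a1.trans ?_
    have a4' : q γ p = V γ p * ⟪D γ p, T γ p⟫ := by rw [← ip_apply, ← a5]; exact a4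
    have a3' : sm.holderL mu 2 ∞ 2 (q γ) (D u) p = q γ p • D u p := a3
    rw [opR_eq γ u p a14 hne, a2, Pi.sub_apply, a3', a4', a6, a7, a8, a9, a10, a11, a12]
    rfl

/-- All powers of `‖fracDiff 1 γ‖`, `‖γ'(x)‖` and `‖γ'(y)‖` depend smoothly on the curve. -/
lemma exists_weights (hs : 3 / 2 < s) (n : ℕ) (a : ℝ) :
    (∃ W : Sob s n → Lp ℝ ∞ mu, ContDiffOn ℝ ∞ W (embeddings s n) ∧
      ∀ γ ∈ embeddings s n, W γ =ᵐ[mu] fun p => ‖fracDiff 1 γ.fn p‖ ^ a) ∧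
    (∃ W : Sob s n → Lp ℝ ∞ mu, ContDiffOn ℝ ∞ W (embeddings s n) ∧
      ∀ γ ∈ embeddings s n, W γ =ᵐ[mu] fun p => ‖γ.der p.1‖ ^ a) ∧
    (∃ W : Sob s n → Lp ℝ ∞ mu, ContDiffOn ℝ ∞ W (embeddings s n) ∧
      ∀ γ ∈ embeddings s n, W γ =ᵐ[mu] fun p => ‖γ.der p.2‖ ^ a) ∧
    (∃ W : Sob s n → Lp ℝ ∞ (volume : Measure Circ), ContDiffOn ℝ ∞ W (embeddings s n) ∧
      ∀ γ ∈ embeddings s n, W γ =ᵐ[volume] fun x => ‖γ.der x‖ ^ a) := by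
  have key : ∀ {α : Type} [MeasurableSpace α] (μ : Measure α)
      (D : Sob s n →L[ℝ] Lp (Amb n) ∞ μ) (Φ : Sob s n → α → Amb n),
      (∀ u, D u =ᵐ[μ] Φ u) → (∀ γ ∈ embeddings s n, ∃ c > 0, ∀ᵐ x ∂μ, c ≤ ‖Φ γ x‖ ^ 2) →
      ∃ W : Sob s n → Lp ℝ ∞ μ, ContDiffOn ℝ ∞ W (embeddings s n) ∧
        ∀ γ ∈ embeddings s n, W γ =ᵐ[μ] fun x => ‖Φ γ x‖ ^ a := by
    intro α _ μ D Φ hD hpos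
    obtain ⟨W, hW, hW'⟩ := exists_norm_rpow D (M := embeddings s n) (fun γ hγ => by
      obtain ⟨c, hc, h⟩ := hpos γ hγ
      refine ⟨c, hc, ?_⟩
      filter_upwards [h, hD γ] with x h1 h2
      rwa [h2]) a
    refine ⟨W, hW, fun γ hγ => ?_⟩
    filter_upwards [hW' γ hγ, hD γ] with x h1 h2
    rw [h1, h2]
  obtain ⟨Q, hQ⟩ := exists_fracDiff hs n
  obtain ⟨D₁, hD₁⟩ := exists_der_fst hs n
  obtain ⟨D₂, hD₂⟩ := exists_der_snd hs n
  obtain ⟨D, hD⟩ := exists_der hs n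
  refine ⟨key mu Q (fun u => fracDiff 1 u.fn) hQ fun γ hγ => ?_,
    key mu D₁ (fun u p => u.der p.1) hD₁ fun γ hγ => ?_,
    key mu D₂ (fun u p => u.der p.2) hD₂ fun γ hγ => ?_,
    key volume D Sob.der hD fun γ hγ => ?_⟩
  all_goals obtain ⟨c, hc, h1, h2⟩ := exists_ae_lower_bound hs hγ
  · exact ⟨c, hc, h1⟩
  · refine ⟨c, hc, ?_⟩
    filter_upwards [ae_fst_mu h2] with p hp
    exact hp
  · refine ⟨c, hc, ?_⟩
    filter_upwards [ae_snd_mu h2] with p hp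
    exact hp
  · exact ⟨c, hc, h2⟩

/-- The form `b` with values in the functions on `α` is a smooth family of bounded bilinear forms
with values in `L¹(μ)`. -/
def IsSmoothForm {α : Type*} [MeasurableSpace α] (μ : Measure α)
    (b : Sob s n → Sob s n → Sob s n → α → ℝ) : Prop :=
  ∃ β : Sob s n → Sob s n →L[ℝ] Sob s n →L[ℝ] Lp ℝ 1 μ,
    ContDiffOn ℝ ∞ β (embeddings s n) ∧ ∀ γ ∈ embeddings s n, ∀ u v, β γ u v =ᵐ[μ] b γ u v

/-- Evaluation of a bounded bilinear map is continuous and multilinear, so smoothness in operator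
norm upgrades to joint smoothness. -/
lemma IsSmoothForm.smoothIntoL1 {b : Sob s n → Sob s n → Sob s n → Circ × Circ → ℝ}
    (h : IsSmoothForm mu b) : SmoothIntoL1 b := by
  obtain ⟨β, hβ, hb⟩ := h
  refine ⟨fun x => β x.1 x.2.1 x.2.2, ?_, hb⟩
  have h1 : ContDiffOn ℝ ∞ (fun x : Sob s n × Sob s n × Sob s n => β x.1)
      (embeddings s n ×ˢ univ) := hβ.comp contDiff_fst.contDiffOn fun x hx => hx.1
  exact (h1.clm_apply (contDiff_fst.comp contDiff_snd).contDiffOn).clm_apply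
    (contDiff_snd.comp contDiff_snd).contDiffOn

lemma IsSmoothForm.integrable {α : Type*} [MeasurableSpace α] {μ : Measure α}
    {b : Sob s n → Sob s n → Sob s n → α → ℝ} (h : IsSmoothForm μ b) {γ : Sob s n}
    (hγ : γ ∈ embeddings s n) (u v : Sob s n) : Integrable (b γ u v) μ := by
  obtain ⟨β, -, hb⟩ := h
  exact (L1.integrable_coeFn (β γ u v)).congr (hb γ hγ u v)

lemma IsSmoothForm.exists_integral {α : Type*} [MeasurableSpace α] {μ : Measure α}
    {b : Sob s n → Sob s n → Sob s n → α → ℝ} (h : IsSmoothForm μ b) :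
    ∃ g : Sob s n → Sob s n →L[ℝ] Sob s n →L[ℝ] ℝ, ContDiffOn ℝ ∞ g (embeddings s n) ∧
      ∀ γ ∈ embeddings s n, ∀ u v, g γ u v = ∫ x, b γ u v x ∂μ := by
  obtain ⟨β, hβ, hb⟩ := h
  obtain ⟨I, hI⟩ := exists_integral_clm μ
  refine ⟨_, contDiffOn_postcomp I hβ, fun γ hγ u v => ?_⟩
  exact (hI _).trans (integral_congr_ae (hb γ hγ u v))

lemma Lam_eq (γ : Sob s n) (p : Circ × Circ) : Lam γ p = ‖fracDiff 1 γ.fn p‖ ^ (-1 : ℝ) := by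
  rw [Lam, norm_fracDiff_one, Real.rpow_neg_one, mul_inv, inv_inv, div_eq_mul_inv]

/-- The bounded weight `Λ |γ'(x)| |γ'(y)|` multiplies a pairing of two `L²(μ)` fields. -/
lemma isSmoothForm_b1 (hs : 3 / 2 < s) (n : ℕ) :
    IsSmoothForm mu (b1 : Sob s n → Sob s n → Sob s n → Circ × Circ → ℝ) := by
  obtain ⟨S, hS, hS'⟩ := exists_opR hs n
  obtain ⟨⟨W, hW, hW'⟩, -⟩ := exists_weights hs n (-1)
  obtain ⟨-, ⟨W₁, hW₁, hW₁'⟩, ⟨W₂, hW₂, hW₂'⟩, -⟩ := exists_weights hs n 1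
  let m₁ : Sob s n → Lp ℝ ∞ mu := fun γ => mulLp mu (W γ) (W₁ γ)
  let m : Sob s n → Lp ℝ ∞ mu := fun γ => mulLp mu (m₁ γ) (W₂ γ)
  have hm : ContDiffOn ℝ ∞ m (embeddings s n) :=
    contDiffOn_holderL _ (contDiffOn_holderL _ hW hW₁) hW₂
  refine ⟨fun γ => weightedForm (r := 1) (m γ) (S γ), contDiffOn_weightedForm hm hS,
    fun γ hγ u v => ?_⟩
  filter_upwards [coeFn_weightedForm (r := 1) (m γ) (S γ) u v, coeFn_mulLp (m₁ γ) (W₂ γ),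
    coeFn_mulLp (W γ) (W₁ γ), hW' γ hγ, hW₁' γ hγ, hW₂' γ hγ, hS' γ hγ u, hS' γ hγ v]
    with p a1 a2 a3 a4 a5 a6 a7 a8
  have a2' : m γ p = m₁ γ p * W₂ γ p := a2
  have a3' : m₁ γ p = W γ p * W₁ γ p := a3
  rw [a1, a2', a3', a4, a5, a6, a7, a8, b1, Lam_eq, Real.rpow_one, Real.rpow_one]
  ring

lemma exists_b1_self (hs : 3 / 2 < s) (n : ℕ) :
    ∃ ρ : Sob s n → Lp ℝ 1 mu, ContDiffOn ℝ ∞ ρ (embeddings s n) ∧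
      ∀ γ ∈ embeddings s n, ρ γ =ᵐ[mu] b1 γ γ γ := by
  obtain ⟨β, hβ, hb⟩ := isSmoothForm_b1 hs n
  exact ⟨fun γ => β γ γ γ, (hβ.clm_apply contDiffOn_id).clm_apply contDiffOn_id,
    fun γ hγ => hb γ hγ γ γ⟩

/-- Common shape of `b2` and `b3`: the `L¹` density `b1 γ γ γ` times bounded factors. For `b2` the
weight is `Λ²` and `D` is the difference quotient; `b3` is a sum of two such forms, one for each
variable. -/
lemma isSmoothForm_b1_mul (hs : 3 / 2 < s) {W : Sob s n → Lp ℝ ∞ mu}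
    (hW : ContDiffOn ℝ ∞ W (embeddings s n)) (D : Sob s n →L[ℝ] Lp (Amb n) ∞ mu) :
    IsSmoothForm mu fun γ u v p => b1 γ γ γ p * W γ p * ⟪D u p, D v p⟫ := by
  obtain ⟨ρ, hρ, hρ'⟩ := exists_b1_self hs n
  refine ⟨fun γ => weightedForm (r := ∞)
    ((ContinuousLinearMap.mul ℝ ℝ).holderL mu 1 ∞ 1 (ρ γ) (W γ)) D,
    contDiffOn_weightedForm (contDiffOn_holderL _ hρ hW) contDiffOn_const, fun γ hγ u v => ?_⟩
  have e1 := coeFn_holderL (r := 1) (ContinuousLinearMap.mul ℝ ℝ) (ρ γ) (W γ)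
  filter_upwards [coeFn_weightedForm (r := ∞)
    ((ContinuousLinearMap.mul ℝ ℝ).holderL mu 1 ∞ 1 (ρ γ) (W γ)) D u v, e1, hρ' γ hγ]
    with p a1 a2 a3
  rw [a1, a2, a3]
  rfl

lemma IsSmoothForm.congr {α : Type*} [MeasurableSpace α] {μ : Measure α}
    {b c : Sob s n → Sob s n → Sob s n → α → ℝ} (h : IsSmoothForm μ b)
    (hbc : ∀ γ ∈ embeddings s n, ∀ u v, b γ u v =ᵐ[μ] c γ u v) : IsSmoothForm μ c := by
  obtain ⟨β, hβ, hb⟩ := h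
  exact ⟨β, hβ, fun γ hγ u v => (hb γ hγ u v).trans (hbc γ hγ u v)⟩

lemma IsSmoothForm.add {α : Type*} [MeasurableSpace α] {μ : Measure α}
    {b c : Sob s n → Sob s n → Sob s n → α → ℝ} (hb : IsSmoothForm μ b) (hc : IsSmoothForm μ c) :
    IsSmoothForm μ fun γ u v x => b γ u v x + c γ u v x := by
  obtain ⟨β, hβ, hb⟩ := hb
  obtain ⟨β', hβ', hc⟩ := hc
  refine ⟨fun γ => β γ + β' γ, hβ.add hβ', fun γ hγ u v => ?_⟩
  filter_upwards [hb γ hγ u v, hc γ hγ u v, Lp.coeFn_add (β γ u v) (β' γ u v)] with x h1 h2 h3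
  rw [← h1, ← h2]
  exact h3

lemma isSmoothForm_b2 (hs : 3 / 2 < s) (n : ℕ) :
    IsSmoothForm mu (b2 : Sob s n → Sob s n → Sob s n → Circ × Circ → ℝ) := by
  obtain ⟨Q, hQ⟩ := exists_fracDiff hs n
  obtain ⟨⟨W, hW, hW'⟩, -⟩ := exists_weights hs n (-2)
  refine (isSmoothForm_b1_mul hs hW Q).congr fun γ hγ u v => ?_
  filter_upwards [hW' γ hγ, hQ u, hQ v] with p h1 h2 h3
  rw [h1, h2, h3, b2, Lam_eq, ← Real.rpow_natCast, ← Real.rpow_mul (norm_nonneg _)]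
  norm_num
  ring

lemma inner_arcDeriv (γ u v : Sob s n) (x : Circ) :
    ⟪arcDeriv γ u x, arcDeriv γ v x⟫ = ‖γ.der x‖ ^ (-2 : ℝ) * ⟪u.der x, v.der x⟫ := by
  rw [arcDeriv, arcDeriv, real_inner_smul_left, real_inner_smul_right,
    Real.rpow_neg (norm_nonneg _), Real.rpow_two]
  ring

lemma isSmoothForm_b3 (hs : 3 / 2 < s) (n : ℕ) :
    IsSmoothForm mu (b3 : Sob s n → Sob s n → Sob s n → Circ × Circ → ℝ) := by
  obtain ⟨D₁, hD₁⟩ := exists_der_fst hs n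
  obtain ⟨D₂, hD₂⟩ := exists_der_snd hs n
  obtain ⟨-, ⟨W₁, hW₁, hW₁'⟩, ⟨W₂, hW₂, hW₂'⟩, -⟩ := exists_weights hs n (-2)
  refine ((isSmoothForm_b1_mul hs hW₁ D₁).add (isSmoothForm_b1_mul hs hW₂ D₂)).congr
    fun γ hγ u v => ?_
  filter_upwards [hW₁' γ hγ, hW₂' γ hγ, hD₁ u, hD₁ v, hD₂ u, hD₂ v] with p h1 h2 h3 h4 h5 h6
  rw [h1, h2, h3, h4, h5, h6, b3, inner_arcDeriv, inner_arcDeriv]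
  ring

lemma isSmoothForm_h1Density (hs : 3 / 2 < s) (n : ℕ) :
    IsSmoothForm volume (h1Density : Sob s n → Sob s n → Sob s n → Circ → ℝ) := by
  -- The exponent `-1` is `-2` from the two arc length derivatives plus `1` from the length element.
  obtain ⟨-, -, -, ⟨W, hW, hW'⟩⟩ := exists_weights hs n (-1)
  obtain ⟨D, hD⟩ := exists_der_two s n
  refine ⟨fun γ => weightedForm (r := 1) (W γ) D, contDiffOn_weightedForm hW contDiffOn_const,
    fun γ hγ u v => ?_⟩
  obtain ⟨c, hc, -, hpos⟩ := exists_ae_lower_bound hs hγ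
  filter_upwards [coeFn_weightedForm (r := 1) (W γ) D u v, hW' γ hγ, hD u, hD v, hpos]
    with x h1 h2 h3 h4 h5
  have hne : ‖γ.der x‖ ≠ 0 := fun h0 => by
    rw [h0] at h5
    norm_num at h5
    linarith
  rw [h1, h2, h3, h4, h1Density, inner_arcDeriv, Real.rpow_neg_one,
    Real.rpow_neg (norm_nonneg _), Real.rpow_two]
  field_simp

lemma isSmoothForm_l2Density (hs : 3 / 2 < s) (n : ℕ) :
    IsSmoothForm volume (l2Density : Sob s n → Sob s n → Sob s n → Circ → ℝ) := by
  obtain ⟨-, -, -, ⟨W, hW, hW'⟩⟩ := exists_weights hs n 1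
  obtain ⟨D, hD⟩ := exists_fn s n
  refine ⟨fun γ => weightedForm (r := 1) (W γ) D, contDiffOn_weightedForm hW contDiffOn_const,
    fun γ hγ u v => ?_⟩
  filter_upwards [coeFn_weightedForm (r := 1) (W γ) D u v, hW' γ hγ, hD u, hD v]
    with x h1 h2 h3 h4
  rw [h1, h2, h3, h4, l2Density, Real.rpow_one, mul_comm]

end Smoothness

/-! ### From `muGamma` to `mu`, and the metric -/

section Integrals

variable {s : ℝ} {n : ℕ}

/-- Both integrals are rewritten over Lebesgue measure and compared pointwise, so no integrability
is needed. -/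
lemma integral_muGamma (γ : Sob s n) {f h : Circ × Circ → ℝ}
    (hfh : ∀ p, 0 < dist p.2 p.1 → ‖γ.der p.2‖ * ‖γ.der p.1‖ / ‖γ.fn p.2 - γ.fn p.1‖ * f p
      = (dist p.2 p.1)⁻¹ * h p) : ∫ p, f p ∂(muGamma γ) = ∫ p, h p ∂mu := by
  have h1 : Measurable fun p : Circ × Circ =>
      ENNReal.ofReal (‖γ.der p.2‖ * ‖γ.der p.1‖ / ‖γ.fn p.2 - γ.fn p.1‖) :=
    (((γ.measurable_der.comp measurable_snd).norm.mul
      (γ.measurable_der.comp measurable_fst).norm).div ((γ.measurable_fn.comp measurable_snd).sub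
        (γ.measurable_fn.comp measurable_fst)).norm).ennreal_ofReal
  have h2 : Measurable fun p : Circ × Circ => ENNReal.ofReal (dist p.2 p.1)⁻¹ :=
    (measurable_snd.dist measurable_fst).inv.ennreal_ofReal
  rw [muGamma, mu, integral_withDensity_eq_integral_toReal_smul h1 (by simp),
    integral_withDensity_eq_integral_toReal_smul h2 (by simp)]
  congr 1 with p
  rw [ENNReal.toReal_ofReal (by positivity), ENNReal.toReal_ofReal (by positivity), smul_eq_mul,
    smul_eq_mul]
  -- On the diagonal both densities vanish, being divisions by zero.
  rcases (dist_nonneg (x := p.2) (y := p.1)).eq_or_lt with h0 | h0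
  · have : p.2 = p.1 := dist_eq_zero.1 h0.symm
    rw [← h0, this]
    simp
  · exact hfh p h0

/-- No embedding hypothesis is needed: where `γ(y) = γ(x)` both sides vanish by division by zero.
The same applies to `B2_eq` and `B3_eq`. -/
lemma B1_eq (γ u v : Sob s n) : B1 γ u v = ∫ p, b1 γ u v p ∂mu := by
  refine integral_muGamma γ fun p hp => ?_
  rw [b1, Lam]
  field_simp

lemma B2_eq (γ u v : Sob s n) : B2 γ u v = ∫ p, b2 γ u v p ∂mu := by
  refine integral_muGamma γ fun p hp => ?_
  rw [b2, b1, Lam, fracDiff, fracDiff, real_inner_self_eq_norm_sq, Real.rpow_one,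
    real_inner_smul_left, real_inner_smul_left, real_inner_smul_right, real_inner_smul_right]
  field_simp

lemma B3_eq (γ u v : Sob s n) : B3 γ u v = ∫ p, b3 γ u v p ∂mu := by
  refine integral_muGamma γ fun p hp => ?_
  rw [b3, b1, Lam, real_inner_self_eq_norm_sq]
  field_simp

lemma exists_smooth_metric (hs : 3 / 2 < s) (n : ℕ) :
    ∃ g : Sob s n → Sob s n →L[ℝ] Sob s n →L[ℝ] ℝ, ContDiffOn ℝ ∞ g (embeddings s n) ∧
      ∀ γ ∈ embeddings s n, ∀ u v, g γ u v = G γ u v := by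
  obtain ⟨g₁, hg₁, h₁⟩ := (isSmoothForm_b1 hs n).exists_integral
  obtain ⟨g₂, hg₂, h₂⟩ := (isSmoothForm_b2 hs n).exists_integral
  obtain ⟨g₃, hg₃, h₃⟩ := (isSmoothForm_b3 hs n).exists_integral
  obtain ⟨g₄, hg₄, h₄⟩ := (isSmoothForm_h1Density hs n).exists_integral
  obtain ⟨g₅, hg₅, h₅⟩ := (isSmoothForm_l2Density hs n).exists_integral
  refine ⟨fun γ => (2 : ℝ) • g₁ γ + (2 * s + 1) • g₂ γ + g₃ γ + g₄ γ + g₅ γ,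
    ((((hg₁.const_smul 2).add (hg₂.const_smul (2 * s + 1))).add hg₃).add hg₄).add hg₅,
    fun γ hγ u v => ?_⟩
  simp only [add_apply, smul_apply, smul_eq_mul,
    h₁ γ hγ, h₂ γ hγ, h₃ γ hγ, h₄ γ hγ, h₅ γ hγ, G, B1_eq, B2_eq, B3_eq]

end Integrals

end TangentPoint

/-! ### The theorem -/

open TangentPoint
theorem mainTheorem8 (n : ℕ) (s : ℝ) (hs : 3 / 2 < s) (hs2 : s < 2) :
    IsOpen (embeddings s n) ∧
    (∃ g : Sob s n → Sob s n →L[ℝ] Sob s n →L[ℝ] ℝ,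
      ContDiffOn ℝ ∞ g (embeddings s n) ∧
      ∀ γ ∈ embeddings s n, ∀ u v : Sob s n, g γ u v = G γ u v) ∧
    (SmoothIntoL1 (b1 : Sob s n → Sob s n → Sob s n → Circ × Circ → ℝ) ∧
      SmoothIntoL1 (b2 : Sob s n → Sob s n → Sob s n → Circ × Circ → ℝ) ∧
      SmoothIntoL1 (b3 : Sob s n → Sob s n → Sob s n → Circ × Circ → ℝ)) ∧
    ∀ γ ∈ embeddings s n, ∀ u v : Sob s n,
      B1 γ u v = ∫ p, b1 γ u v p ∂mu ∧
      B2 γ u v = ∫ p, b2 γ u v p ∂mu ∧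
      B3 γ u v = ∫ p, b3 γ u v p ∂mu ∧
      MeasureTheory.Integrable (h1Density γ u v) ∧
      MeasureTheory.Integrable (l2Density γ u v) :=
  ⟨isOpen_embeddings hs n, exists_smooth_metric hs n,
    ⟨(isSmoothForm_b1 hs n).smoothIntoL1, (isSmoothForm_b2 hs n).smoothIntoL1,
      (isSmoothForm_b3 hs n).smoothIntoL1⟩,
    fun γ hγ u v => ⟨B1_eq γ u v, B2_eq γ u v, B3_eq γ u v,
      (isSmoothForm_h1Density hs n).integrable hγ u v,
      (isSmoothForm_l2Density hs n).integrable hγ u v⟩⟩
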